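/- Let $q\ge 1$, let $\varTheta\subset\mathbb R^q$ be open, bounded and convex with closure $\varTheta^c$, and let $\theta\in\varTheta$. Let $a:[0,\infty)\times\varTheta^c\to\mathbb R$ be continuous, with $a(t,\cdot)\in C^1(\varTheta)$ for every $t\ge 0$. One observes $X(t)=a(t,\theta)+\varepsilon(t)$, where the noise $\varepsilon=\{\varepsilon(t),\,t\in\mathbb R\}$, defined on a probability space $(\Omega,\mathfrak F,P)$, satisfies: (N1) $\varepsilon$ is mean-square continuous, almost surely has continuous paths, and $E\varepsilon(t)=0$ for all $t$. (N4)(i) $\varepsilon(t)=\int_{-\infty}^t\psi(t-s)\,d\xi(s)$ (mean-square stochastic integral), where $\psi:\mathbb R\to\mathbb R$ vanishes on $(-\infty,0)$ and $\int_0^\infty\psi^2(t)\,dt<\infty$, and $\xi=\{\xi(t),\,t\in\mathbb R\}$ is a mean-square continuous process with orthogonal increments, $E\xi(t)=0$, $E|\xi(t+s)-\xi(t)|^2=s$ for $t\in\mathbb R$, $s>0$, which is jointly strictly sub-Gaussian: for all $n\ge1$, $t_1,\dots,t_n\in\mathbb R$, $\varDelta_1,\dots,\varDelta_n\in\mathbb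 R$, $$E\exp\Bigl\{\sum_k\varDelta_k\xi(t_k)\Bigr\}\le\exp\Bigl\{\tfrac12\sum_{k,l}E[\xi(t_k)\xi(t_l)]\,\varDelta_k\varDelta_l\Bigr\}.$$ (N4)(ii) $0<f_0:=\sup_{\lambda\in\mathbb R}|h(i\lambda)|^2<\infty$, where $h(i\lambda)=(2\pi)^{-1/2}\int_0^\infty\psi(t)e^{-i\lambda t}\,dt$; the integral is understood as the limit in $L^2(d\lambda)$ of the integrals over $[0,A]$ as $A\to\infty$, and $h$ may be any version of this limit. For $T>0$, a least squares estimator is any random vector $\theta_T$ with values in $\varTheta^c$ that minimizes $Q_T(\tau)=\int_0^T[X(t)-a(t,\tau)]^2dt$ over $\tau\in\varTheta^c$ almost surely. Let $d_T(\theta)=\mathrm{diag}(d_{1T}(\theta),\dots,d_{qT}(\theta))$ with $d_{iT}^2(\theta)=\int_0^T\bigl(\tfrac{\partial}{\partial\theta_i}a(t,\theta)\bigr)^2dt$, and put $U_T(\theta)=d_T(\theta)(\varTheta^c-\theta)$, $\varGamma_{T,\theta,R}=U_T(\theta)\cap\{u:R\le\|u\|\le R+1\}$, $\varDelta(t,u)=a(t,\theta+d_T^{-1}(\theta)u)-a(t,\theta)$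 and $\varPhi_T(u,v)=\int_0^T(\varDelta(t,u)-\varDelta(t,v))^2dt$ for $u,v\in U_T(\theta)$. Let $g=g_T(R)$, $T,R>0$, be a function such that for each fixed $T$, $g_T(R)$ is nondecreasing in $R$ and $g_T(R)\to\infty$ as $R\to\infty$, and such that for every $r>0$, $R^re^{-g_T(R)}\to0$ as $R,T\to\infty$. Suppose that for some $T_0,R_0\ge0$, $\delta\in(0,\tfrac12)$, $\varkappa>0$, $\rho\in(0,1]$ and real polynomials $\gamma_1,\gamma_2$, with $d_0=2\pi f_0$, the following holds for all $T>T_0$ and $R>R_0$: $0<d_{iT}(\theta)<\infty$ for $i=1,\dots,q$, and (R1)(i) $\varPhi_T(u,v)\le\gamma_1(R)\|u-v\|^{2\rho}$ for all $u,v\in\varGamma_{T,\theta,R}$ with $\|u-v\|\le\varkappa$; (R1)(ii) $\varPhi_T(u,0)\le\gamma_2(R)$ for all $u\in\varGamma_{T,\theta,R}$; (R2) $\varPhi_T(u,0)\ge2d_0\delta^{-2}g_T(R)$ for all $u\in\varGamma_{T,\theta,R}$. Then for every $\beta>0$ there exist constants $B_0,b_0>0$ with $b_0\ge\frac{\rho}{\rho+q}-\beta$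 such that for all $T>T_0$, every least squares estimator $\theta_T$, and all $R>R_0$, $$P\bigl\{\|d_T(\theta)(\theta_T-\theta)\|\ge R\bigr\}\le B_0\exp\{-b_0\,g_T(R)\}.$$ -/

import Mathlib

open MeasureTheory ProbabilityTheory Set Filter Topology

noncomputable section

namespace LSEDeviation

/-! ### Strictly sub-Gaussian vectors and processes -/

/-- A random vector `ξ = (ξ 1, …, ξ n)` is strictly sub-Gaussian if
`E exp ⟨ξ, Δ⟩ ≤ exp (⟨B Δ, Δ⟩ / 2)` for all `Δ ∈ ℝⁿ`, where `B i j = E (ξ i * ξ j)`.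
The expectation on the left is required to be finite; in particular all second moments exist. -/
def IsStrictlySubGaussian {Ω : Type*} [MeasurableSpace Ω] (P : Measure Ω) {n : ℕ}
    (ξ : Fin n → Ω → ℝ) : Prop :=
  (∀ i, Measurable (ξ i)) ∧
    ∀ Δ : Fin n → ℝ,
      Integrable (fun ω => Real.exp (∑ i, ξ i ω * Δ i)) P ∧
      ∫ ω, Real.exp (∑ i, ξ i ω * Δ i) ∂P ≤
        Real.exp ((1 / 2) * ∑ i, ∑ j, (∫ ω, ξ i ω * ξ j ω ∂P) * Δ i * Δ j)

/-- A process is jointly strictly sub-Gaussian if all vectors of its values at finitely many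
times are strictly sub-Gaussian. -/
def IsJointlyStrictlySubGaussian {Ω : Type*} [MeasurableSpace Ω] (P : Measure Ω)
    (ξ : ℝ → Ω → ℝ) : Prop :=
  ∀ (n : ℕ) (t : Fin n → ℝ), IsStrictlySubGaussian P (fun k => ξ (t k))

/-- Mean-square continuity of a second-order process. -/
def IsMeanSquareContinuous {Ω : Type*} [MeasurableSpace Ω] (P : Measure Ω)
    (ξ : ℝ → Ω → ℝ) : Prop :=
  (∀ t, MemLp (ξ t) 2 P) ∧
    ∀ t, Tendsto (fun s => ∫ ω, (ξ s ω - ξ t ω) ^ 2 ∂P) (𝓝 t) (𝓝 0)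

/-- A centered process with mean-square continuous and almost surely continuous paths. -/
structure IsContinuousCenteredNoise {Ω : Type*} [MeasurableSpace Ω] (P : Measure Ω)
    (ε : ℝ → Ω → ℝ) : Prop where
  measurable : ∀ t, Measurable (ε t)
  meanSquareContinuous : IsMeanSquareContinuous P ε
  continuousPaths : ∀ᵐ ω ∂P, Continuous (fun t => ε t ω)
  centered : ∀ t, ∫ ω, ε t ω ∂P = 0

/-! ### Mean-square stochastic integrals and filtered noise -/

/-- A step function `∑ c l * 1_[α l, β l)` on the real line. -/
structure StepFunction where
  n : ℕ
  c : Fin n → ℝ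
  α : Fin n → ℝ
  β : Fin n → ℝ
  le : ∀ l, α l ≤ β l

/-- The values of a step function. -/
def StepFunction.eval (S : StepFunction) (s : ℝ) : ℝ :=
  ∑ l, S.c l * (Ico (S.α l) (S.β l)).indicator (fun _ => (1 : ℝ)) s

/-- The elementary stochastic integral `∑ c l * (ξ (β l) - ξ (α l))` of a step function. -/
def StepFunction.integral {Ω : Type*} (S : StepFunction) (ξ : ℝ → Ω → ℝ) (ω : Ω) : ℝ :=
  ∑ l, S.c l * (ξ (S.β l) ω - ξ (S.α l) ω)

/-- `Y` is (a version of) the mean-square integral `∫ φ dξ` over the real line: step functions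
converge to `φ` in `L²(ℝ)` and their elementary integrals converge to `Y` in mean square.
When `ξ` has orthogonal increments with `E |ξ (t + s) - ξ t|² = s`, the elementary integral is an
isometry, so `Y` exists and is almost surely unique for each `φ ∈ L²(ℝ)`. -/
def IsMeanSquareIntegral {Ω : Type*} [MeasurableSpace Ω] (P : Measure Ω)
    (ξ : ℝ → Ω → ℝ) (φ : ℝ → ℝ) (Y : Ω → ℝ) : Prop :=
  ∃ S : ℕ → StepFunction,
    Tendsto (fun m => eLpNorm (fun s => φ s - (S m).eval s) 2 volume) atTop (𝓝 0) ∧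
    Tendsto (fun m => eLpNorm (fun ω => Y ω - (S m).integral ξ ω) 2 P) atTop (𝓝 0)

/-- A centered, mean-square continuous, jointly strictly sub-Gaussian process with orthogonal
increments and `E |ξ (t + s) - ξ t|² = s` (an integrated white noise). -/
structure IsSubGaussianIntegratedWhiteNoise {Ω : Type*} [MeasurableSpace Ω] (P : Measure Ω)
    (ξ : ℝ → Ω → ℝ) : Prop where
  meanSquareContinuous : IsMeanSquareContinuous P ξ
  subGaussian : IsJointlyStrictlySubGaussian P ξ
  orthogonalIncrements : ∀ t₁ t₂ t₃ t₄ : ℝ, t₁ < t₂ → t₂ ≤ t₃ → t₃ < t₄ →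
    ∫ ω, (ξ t₂ ω - ξ t₁ ω) * (ξ t₄ ω - ξ t₃ ω) ∂P = 0
  centered : ∀ t, ∫ ω, ξ t ω ∂P = 0
  incrementVariance : ∀ t s : ℝ, 0 < s → ∫ ω, |ξ (t + s) ω - ξ t ω| ^ 2 ∂P = s

/-- `ε t = ∫_{-∞}^t ψ (t - s) dξ s` for a kernel `ψ ∈ L²` vanishing on the negative half-line. -/
structure IsFilteredNoise {Ω : Type*} [MeasurableSpace Ω] (P : Measure Ω)
    (ξ : ℝ → Ω → ℝ) (ψ : ℝ → ℝ) (ε : ℝ → Ω → ℝ) : Prop where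
  driver : IsSubGaussianIntegratedWhiteNoise P ξ
  causal : ∀ t < 0, ψ t = 0
  squareIntegrable : MemLp ψ 2 volume
  representation : ∀ t, IsMeanSquareIntegral P ξ (fun s => ψ (t - s)) (ε t)

/-- The truncated transform `(2π)^(-1/2) ∫_0^A ψ t * exp (-i x t) dt`. -/
def truncatedTransfer (ψ : ℝ → ℝ) (A x : ℝ) : ℂ :=
  (((Real.sqrt (2 * Real.pi))⁻¹ : ℝ) : ℂ) *
    ∫ t in (0 : ℝ)..A, (ψ t : ℂ) * Complex.exp (-(Complex.I * (x : ℂ) * (t : ℂ)))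

/-- `h x`, standing for `h (i x)`, is a version of the transfer function
`(2π)^(-1/2) ∫_0^∞ ψ t * exp (-i x t) dt` of the filter `ψ`. As `ψ` is only assumed to be square
integrable on the half-line, the integral is the Fourier--Plancherel one, that is, the limit in
`L²(ℝ)` of the integrals over `[0, A]`. If `ψ` is integrable, the absolutely convergent integral
is such a version. -/
def IsTransferFunction (ψ : ℝ → ℝ) (h : ℝ → ℂ) : Prop :=
  MemLp h 2 volume ∧
    Tendsto (fun A : ℝ => eLpNorm (fun x => truncatedTransfer ψ A x - h x) 2 volume)
      atTop (𝓝 0)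

/-! ### The regression model -/

/-- The regression function `a t τ` is jointly continuous on `[0, ∞) × closure Θ`, and
continuously differentiable in `τ ∈ Θ` for each `t ≥ 0`. -/
structure IsRegressionFunction {q : ℕ} (Θ : Set (EuclideanSpace ℝ (Fin q)))
    (a : ℝ → EuclideanSpace ℝ (Fin q) → ℝ) : Prop where
  continuousOn : ContinuousOn (Function.uncurry a) (Ici 0 ×ˢ closure Θ)
  contDiffOn : ∀ t, 0 ≤ t → ContDiffOn ℝ 1 (a t) Θ

/-- The observations `X t = a t θ + ε t`. -/
def observation {Ω : Type*} {q : ℕ} (a : ℝ → EuclideanSpace ℝ (Fin q) → ℝ)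
    (θ : EuclideanSpace ℝ (Fin q)) (ε : ℝ → Ω → ℝ) (t : ℝ) (ω : Ω) : ℝ :=
  a t θ + ε t ω

/-- The least squares functional `Q_T τ = ∫_0^T (X t - a t τ)² dt`. -/
def leastSquares {Ω : Type*} {q : ℕ} (a : ℝ → EuclideanSpace ℝ (Fin q) → ℝ)
    (X : ℝ → Ω → ℝ) (T : ℝ) (τ : EuclideanSpace ℝ (Fin q)) (ω : Ω) : ℝ :=
  ∫ t in (0 : ℝ)..T, (X t ω - a t τ) ^ 2

/-- A least squares estimator from the observations on `[0, T]`: a random vector with values in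
`closure Θ` at which `Q_T` attains its infimum over `closure Θ`. -/
structure IsLeastSquaresEstimator {Ω : Type*} [MeasurableSpace Ω] (P : Measure Ω) {q : ℕ}
    (Θ : Set (EuclideanSpace ℝ (Fin q))) (a : ℝ → EuclideanSpace ℝ (Fin q) → ℝ)
    (X : ℝ → Ω → ℝ) (T : ℝ) (est : Ω → EuclideanSpace ℝ (Fin q)) : Prop where
  measurable : Measurable est
  mem : ∀ᵐ ω ∂P, est ω ∈ closure Θ
  isMinOn : ∀ᵐ ω ∂P, IsMinOn (fun τ => leastSquares a X T τ ω) (closure Θ) (est ω)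

/-- The `i`-th diagonal entry `d_{iT}(θ) = (∫_0^T (∂a/∂θ_i (t, θ))² dt)^(1/2)` of the norming
matrix. -/
def normEntry {q : ℕ} (a : ℝ → EuclideanSpace ℝ (Fin q) → ℝ) (θ : EuclideanSpace ℝ (Fin q))
    (T : ℝ) (i : Fin q) : ℝ :=
  Real.sqrt (∫ t in (0 : ℝ)..T, (fderiv ℝ (a t) θ (EuclideanSpace.single i 1)) ^ 2)

/-- The norming matrix `d_T(θ) = diag (d_{iT}(θ))`, applied to a vector. -/
def norming {q : ℕ} (a : ℝ → EuclideanSpace ℝ (Fin q) → ℝ) (θ : EuclideanSpace ℝ (Fin q))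
    (T : ℝ) (x : EuclideanSpace ℝ (Fin q)) : EuclideanSpace ℝ (Fin q) :=
  WithLp.toLp 2 (fun i => normEntry a θ T i * x i)

/-- The inverse `d_T(θ)⁻¹` of the norming matrix, applied to a vector. -/
def normingInv {q : ℕ} (a : ℝ → EuclideanSpace ℝ (Fin q) → ℝ) (θ : EuclideanSpace ℝ (Fin q))
    (T : ℝ) (u : EuclideanSpace ℝ (Fin q)) : EuclideanSpace ℝ (Fin q) :=
  WithLp.toLp 2 (fun i => (normEntry a θ T i)⁻¹ * u i)

/-- `U_T(θ) = d_T(θ) (closure Θ - θ)`. -/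
def localDomain {q : ℕ} (Θ : Set (EuclideanSpace ℝ (Fin q)))
    (a : ℝ → EuclideanSpace ℝ (Fin q) → ℝ) (θ : EuclideanSpace ℝ (Fin q)) (T : ℝ) :
    Set (EuclideanSpace ℝ (Fin q)) :=
  (fun τ => norming a θ T (τ - θ)) '' closure Θ

/-- The shell `Γ_{T,θ,R} = U_T(θ) ∩ {u : R ≤ ‖u‖ ≤ R + 1}`. -/
def shell {q : ℕ} (Θ : Set (EuclideanSpace ℝ (Fin q)))
    (a : ℝ → EuclideanSpace ℝ (Fin q) → ℝ) (θ : EuclideanSpace ℝ (Fin q)) (T R : ℝ) :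
    Set (EuclideanSpace ℝ (Fin q)) :=
  localDomain Θ a θ T ∩ {u | R ≤ ‖u‖ ∧ ‖u‖ ≤ R + 1}

/-- `Δ(t, u) = a (t, θ + d_T(θ)⁻¹ u) - a (t, θ)`. -/
def localIncrement {q : ℕ} (a : ℝ → EuclideanSpace ℝ (Fin q) → ℝ)
    (θ : EuclideanSpace ℝ (Fin q)) (T t : ℝ) (u : EuclideanSpace ℝ (Fin q)) : ℝ :=
  a t (θ + normingInv a θ T u) - a t θ

/-- `Φ_T(u, v) = ∫_0^T (Δ(t, u) - Δ(t, v))² dt`. -/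
def discrepancy {q : ℕ} (a : ℝ → EuclideanSpace ℝ (Fin q) → ℝ)
    (θ : EuclideanSpace ℝ (Fin q)) (T : ℝ) (u v : EuclideanSpace ℝ (Fin q)) : ℝ :=
  ∫ t in (0 : ℝ)..T, (localIncrement a θ T t u - localIncrement a θ T t v) ^ 2

/-- The family `G` of rate functions `g T R`, `T > 0`, `R > 0`: for fixed `T`, `g T R` increases
to infinity as `R → ∞`, and `R ^ r * exp (- g T R) → 0` as `R, T → ∞` for each `r > 0`. -/
structure IsRateFunction (g : ℝ → ℝ → ℝ) : Prop where
  mono : ∀ T, 0 < T → MonotoneOn (g T) (Ioi 0)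
  tendsto : ∀ T, 0 < T → Tendsto (g T) atTop atTop
  decay : ∀ r : ℝ, 0 < r →
    Tendsto (fun p : ℝ × ℝ => p.2 ^ r * Real.exp (-(g p.1 p.2))) (atTop ×ˢ atTop) (𝓝 0)

/-- Upper bounds on `Φ_T` on the shells for `T > T₀`, `R > R₀`, with polynomials `γ₁`, `γ₂`
in `R`. -/
structure DiscrepancyUpperBound {q : ℕ} (Θ : Set (EuclideanSpace ℝ (Fin q)))
    (a : ℝ → EuclideanSpace ℝ (Fin q) → ℝ) (θ : EuclideanSpace ℝ (Fin q))
    (T₀ R₀ κ ρ : ℝ) (γ₁ γ₂ : Polynomial ℝ) : Prop where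
  increment : ∀ T > T₀, ∀ R > R₀, ∀ u ∈ shell Θ a θ T R, ∀ v ∈ shell Θ a θ T R,
    ‖u - v‖ ≤ κ → discrepancy a θ T u v ≤ γ₁.eval R * ‖u - v‖ ^ (2 * ρ)
  growth : ∀ T > T₀, ∀ R > R₀, ∀ u ∈ shell Θ a θ T R, discrepancy a θ T u 0 ≤ γ₂.eval R

/-- Lower bound `Φ_T(u, 0) ≥ 2 d₀ δ⁻² g_T(R)` on the shells for `T > T₀`, `R > R₀`. -/
def DiscrepancyLowerBound {q : ℕ} (Θ : Set (EuclideanSpace ℝ (Fin q)))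
    (a : ℝ → EuclideanSpace ℝ (Fin q) → ℝ) (θ : EuclideanSpace ℝ (Fin q))
    (T₀ R₀ δ d₀ : ℝ) (g : ℝ → ℝ → ℝ) : Prop :=
  ∀ T > T₀, ∀ R > R₀, ∀ u ∈ shell Θ a θ T R,
    2 * d₀ * (δ ^ 2)⁻¹ * g T R ≤ discrepancy a θ T u 0

end LSEDeviation

end

namespace LSEDeviation

/-! ### The Fourier transform on `L¹ ∩ L²` and bounded Fourier multipliers -/

/-! Let u = d_T(θ)(θ_T − θ) be the normed error and W(u) = ∫₀^T Δ(t,u) ε(t) dt. Comparing the least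
squares functional at θ_T with its value at θ gives Φ_T(u,0) ≤ 2W(u). A deviation of size at least R
therefore forces this inequality at a point of one of the shells of inner radius R + j, and it
suffices to bound the probability of that on each shell and to sum over j.

The main fact about the noise is that W(u) − W(v) is sub-Gaussian with variance proxy 2πf₀ Φ_T(u,v).
An integral ∫ f ε is a limit of finite combinations of values of ε, which are mean-square integrals
against ξ. Strict sub-Gaussianity and the isometry bound their exponential moments through the L²
norms of the kernels, and Fatou's lemma gives the limit
(`IsFilteredNoise.lintegral_exp_integral_mul_le`). The limiting kernel s ↦ ∫ f(t) ψ(t − s) dt has L²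
norm at most √(2πf₀) ‖f‖, because on the Fourier side the filter is multiplication by √(2π) h
(`eLpNorm_filter_le`).

On one shell (`exists_shell_bound`), chaining (`exists_net_measure_le`) finds a net of polynomially
many points above which W rises by at most 1, outside an event that is again small. At a net point
v, Φ_T(v,0) ≥ 8d₀g because δ < 1/2, so W(v) ≥ (2/5)Φ_T(v,0) has probability at most exp(−16g/25).
The surplus 16/25 − 1/2 absorbs the polynomial factors through the rate condition and leaves a
summable series. So b₀ = 1/2 is reached for every β, and ρ/(ρ + q) ≤ 1/2 when q ≥ 1, as ρ ≤ 1; q = 0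
is trivial.

The rate condition only speaks of T and R both large. For bounded T the local domains are uniformly
bounded, so far shells are empty, and by convexity an empty shell is almost surely not crossed. For
bounded R, γ₂ bounds g on nonempty shells, so a large B₀ makes the claim trivial. -/

open scoped ContDiff in
open FourierTransform SchwartzMap in
/-- The `L²` Fourier transform of a function in `L¹ ∩ L²` is its Fourier integral. -/
theorem coeFn_fourier_toLp {f : ℝ → ℂ} (h1 : Integrable f) (h2 : MemLp f 2 volume) :
    ((𝓕 (h2.toLp f) : Lp ℂ 2 (volume : Measure ℝ)) : ℝ → ℂ) =ᵐ[volume] 𝓕 f := by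
  have hcont : Continuous (𝓕 f) :=
    VectorFourier.fourierIntegral_continuous Real.continuous_fourierChar
      (by exact continuous_inner) h1
  refine ae_eq_of_integral_contDiff_smul_eq
    ((Lp.memLp (𝓕 (h2.toLp f))).locallyIntegrable (by norm_num)) hcont.locallyIntegrable ?_
  intro g g_smooth g_cpt
  have hg₁ : HasCompactSupport (Complex.ofRealCLM ∘ g) := g_cpt.comp_left rfl
  have hg₂ : ContDiff ℝ ∞ (Complex.ofRealCLM ∘ g) := by fun_prop
  set G : 𝓢(ℝ, ℂ) := hg₁.toSchwartzMap hg₂ with hG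
  have hGg : ∀ x, G x = (g x : ℂ) := fun x => rfl
  have e := DFunLike.congr_fun (Lp.fourier_toTemperedDistribution_eq (h2.toLp f)) G
  rw [TemperedDistribution.fourier_apply, Lp.toTemperedDistribution_apply,
    Lp.toTemperedDistribution_apply] at e
  have e1 : ∫ x, (𝓕 G) x • (h2.toLp f) x = ∫ x, (𝓕 (G : ℝ → ℂ)) x • f x := by
    refine integral_congr_ae ?_
    filter_upwards [h2.coeFn_toLp] with x hx
    rw [hx, SchwartzMap.fourier_coe]
  have e2 : ∫ x, (𝓕 (G : ℝ → ℂ)) x • f x = ∫ x, G x • (𝓕 f) x :=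
    VectorFourier.integral_fourierIntegral_smul_eq_flip (L := innerₗ ℝ)
      Real.continuous_fourierChar continuous_inner G.integrable h1 |>.trans (by
        simp only [flip_innerₗ]; rfl)
  rw [e1, e2] at e
  simpa [hGg] using e.symm

open FourierTransform in
/-- Plancherel's identity for functions in `L¹ ∩ L²`. -/
theorem eLpNorm_fourier_eq {f : ℝ → ℂ} (h1 : Integrable f) (h2 : MemLp f 2 volume) :
    eLpNorm (𝓕 f) 2 volume = eLpNorm f 2 volume := by
  rw [← eLpNorm_congr_ae (coeFn_fourier_toLp h1 h2)]
  have := Lp.norm_fourier_eq (h2.toLp f)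
  rw [Lp.norm_def, Lp.norm_def, ENNReal.toReal_eq_toReal_iff' (Lp.eLpNorm_ne_top _)
    (Lp.eLpNorm_ne_top _), eLpNorm_congr_ae h2.coeFn_toLp] at this
  exact this

/-- A bounded integrable function is square integrable. -/
theorem memLp_two_of_integrable_of_bound {f : ℝ → ℂ} (h1 : Integrable f) (C : ℝ)
    (hC : ∀ x, ‖f x‖ ≤ C) : MemLp f 2 volume := by
  rw [memLp_two_iff_integrable_sq_norm h1.1]
  refine (h1.norm.const_mul C).mono' (h1.1.norm.pow 2) (Eventually.of_forall fun x => ?_)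
  rw [Real.norm_of_nonneg (by positivity), pow_two]
  gcongr
  exact hC x

/-- The square integrable function `ψ` cut off to `(0, A]`. -/
noncomputable def cutoff (ψ : ℝ → ℝ) (A : ℝ) : ℝ → ℝ := (Ioc 0 A).indicator ψ

theorem memLp_cutoff {ψ : ℝ → ℝ} (hψ : MemLp ψ 2 volume) (A : ℝ) :
    MemLp (cutoff ψ A) 2 volume := hψ.indicator measurableSet_Ioc

theorem integrable_cutoff {ψ : ℝ → ℝ} (hψ : MemLp ψ 2 volume) (A : ℝ) :
    Integrable (cutoff ψ A) := by
  rw [cutoff, integrable_indicator_iff measurableSet_Ioc]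
  exact (hψ.restrict (Ioc 0 A)).integrable (by norm_num)

open FourierTransform in
-- The integral 𝓕 uses the phase e^(−2πiwt) without prefactor, the transfer function uses e^(−ixt)
-- with (2π)^(−1/2); hence the argument 2πw and the factor √(2π).
theorem fourier_cutoff {ψ : ℝ → ℝ} {A : ℝ} (hA : 0 ≤ A) (w : ℝ) :
    𝓕 (fun x => (cutoff ψ A x : ℂ)) w =
      (Real.sqrt (2 * Real.pi) : ℂ) * truncatedTransfer ψ A (2 * Real.pi * w) := by
  have hpi : (Real.sqrt (2 * Real.pi) : ℂ) ≠ 0 := by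
    exact_mod_cast (Real.sqrt_pos.2 (by positivity)).ne'
  rw [truncatedTransfer, Complex.ofReal_inv, ← mul_assoc, mul_inv_cancel₀ hpi, one_mul,
    Real.fourier_real_eq_integral_exp_smul, intervalIntegral.integral_of_le hA,
    ← integral_indicator measurableSet_Ioc]
  congr 1
  ext t
  by_cases ht : t ∈ Ioc 0 A
  · simp only [cutoff, indicator_of_mem ht, smul_eq_mul]
    rw [mul_comm]
    congr 2
    push_cast
    ring
  · simp [cutoff, indicator_of_notMem ht]

/-- Dilation by c scales the L² norm by c^(−1/2). An inequality suffices, since it is applied with c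
= 2π to an error term that tends to zero. -/
theorem eLpNorm_comp_mul_left {E : Type*} [NormedAddCommGroup E] (g : ℝ → E) {c : ℝ}
    (hc : 1 ≤ c) : eLpNorm (fun x => g (c * x)) 2 volume ≤ eLpNorm g 2 volume := by
  have hc0 : c ≠ 0 := by positivity
  have e : MeasurableEmbedding (fun x : ℝ => c * x) :=
    (Homeomorph.mulLeft₀ c hc0).measurableEmbedding
  have := e.eLpNorm_map_measure (g := g) (p := 2) (μ := volume)
  rw [Real.map_volume_mul_left hc0] at this
  change eLpNorm (g ∘ fun x : ℝ => c * x) 2 volume ≤ _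
  rw [← this]
  refine eLpNorm_mono_measure _ ?_
  refine Measure.le_iff.2 fun s _ => ?_
  rw [Measure.smul_apply, smul_eq_mul]
  refine (mul_le_of_le_one_left zero_le ?_)
  rw [ENNReal.ofReal_le_one, abs_of_pos (by positivity)]
  exact inv_le_one_of_one_le₀ hc


theorem integrable_mul_comp_add {f ψ : ℝ → ℝ} (hf : MemLp f 2 volume) (hψ : MemLp ψ 2 volume)
    (s : ℝ) : Integrable (fun t => f t * ψ (t + s)) :=
  hf.integrable_mul (hψ.comp_measurePreserving (measurePreserving_add_right volume s))

open FourierTransform in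
-- The correlation is the convolution of the reflected f with the truncated filter. Truncation makes
-- both factors integrable and the convolution is also bounded, so it lies in L¹ ∩ L², where
-- Plancherel and the convolution theorem apply.
theorem eLpNorm_correlation_cutoff {f ψ : ℝ → ℝ} (hf1 : Integrable f) (hf2 : MemLp f 2 volume)
    (hψ : MemLp ψ 2 volume) {A : ℝ} (hA : 0 ≤ A) :
    AEStronglyMeasurable (fun s => ∫ t, f t * cutoff ψ A (t + s)) volume ∧
    eLpNorm (fun s => ∫ t, f t * cutoff ψ A (t + s)) 2 volume =
      eLpNorm (fun w => 𝓕 (fun x => (f (-x) : ℂ)) w *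
        ((Real.sqrt (2 * Real.pi) : ℂ) * truncatedTransfer ψ A (2 * Real.pi * w))) 2 volume := by
  have hF1 : Integrable (fun x => (f (-x) : ℂ)) := hf1.comp_neg.ofReal
  have hG1 : Integrable (fun x => (cutoff ψ A x : ℂ)) := (integrable_cutoff hψ A).ofReal
  set H := MeasureTheory.convolution (fun x => (f (-x) : ℂ)) (fun x => (cutoff ψ A x : ℂ))
    (ContinuousLinearMap.mul ℂ ℂ) volume with hH
  have hH1 : Integrable H := hF1.integrable_convolution _ hG1
  have key : ∀ s, H s = ((∫ t, f t * cutoff ψ A (t + s) : ℝ) : ℂ) := by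
    intro s
    rw [hH, MeasureTheory.convolution_def, ← integral_neg_eq_self, ← integral_complex_ofReal]
    congr 1
    ext t
    simp [add_comm]
  have hbound : ∀ s, ‖H s‖ ≤ ∫ t, (f t ^ 2 + cutoff ψ A t ^ 2) := by
    intro s
    have i1 := hf2.integrable_sq
    have i2 := (memLp_cutoff hψ A).integrable_sq
    rw [key, Complex.norm_real, integral_add i1 i2,
      ← integral_add_right_eq_self (fun t => cutoff ψ A t ^ 2) s,
      ← integral_add i1 (i2.comp_add_right s)]
    refine norm_integral_le_of_norm_le (i1.add (i2.comp_add_right s))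
      (Eventually.of_forall fun t => ?_)
    rw [Real.norm_eq_abs, abs_le]
    constructor <;> nlinarith [sq_nonneg (f t + cutoff ψ A (t + s)),
      sq_nonneg (f t - cutoff ψ A (t + s))]
  have hH2 := memLp_two_of_integrable_of_bound hH1 _ hbound
  have hnorm : ∀ s, ‖∫ t, f t * cutoff ψ A (t + s)‖ = ‖H s‖ := by
    intro s
    rw [key, Complex.norm_real]
  constructor
  · have := Complex.continuous_re.comp_aestronglyMeasurable hH1.1
    refine this.congr (Eventually.of_forall fun s => ?_)
    simp [key]
  · rw [eLpNorm_congr_norm_ae (Eventually.of_forall hnorm), ← eLpNorm_fourier_eq hH1 hH2]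
    congr 1
    ext w
    rw [hH, Real.fourier_mul_convolution_eq hF1 hG1, fourier_cutoff hA]

open FourierTransform in
/-- Convolution with a filter whose transfer function is bounded by `√f₀` has operator norm at
most `√(2π f₀)` on `L²`. -/
theorem eLpNorm_filter_le {f ψ : ℝ → ℝ} {h : ℝ → ℂ} {f₀ : ℝ} (hf1 : Integrable f)
    (hf2 : MemLp f 2 volume) (hψ : MemLp ψ 2 volume) (hc : ∀ t < 0, ψ t = 0)
    (hh : IsTransferFunction ψ h) (hb : ∀ x, ‖h x‖ ^ 2 ≤ f₀) :
    eLpNorm (fun s => ∫ t, f t * ψ (t - s)) 2 volume ≤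
      ENNReal.ofReal (Real.sqrt (2 * Real.pi * f₀)) * eLpNorm f 2 volume := by
  set F : ℝ → ℂ := fun x => (f (-x) : ℂ) with hF
  have hF1 : Integrable F := hf1.comp_neg.ofReal
  have hF2 : MemLp F 2 volume :=
    (hf2.comp_measurePreserving (Measure.measurePreserving_neg volume)).ofReal
  have hFcont : Continuous (𝓕 F) :=
    VectorFourier.fourierIntegral_continuous Real.continuous_fourierChar
      (by exact continuous_inner) hF1
  have hFnorm : eLpNorm (𝓕 F) 2 volume = eLpNorm f 2 volume := by
    rw [eLpNorm_fourier_eq hF1 hF2,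
      ← eLpNorm_comp_measurePreserving hf2.1 (Measure.measurePreserving_neg volume)]
    exact eLpNorm_congr_norm_ae (Eventually.of_forall fun x => by simp [hF])
  have hFb : ∀ w, ‖𝓕 F w‖ ≤ ∫ x, ‖F x‖ := fun w =>
    VectorFourier.norm_fourierIntegral_le_integral_norm _ _ _ _ w
  -- Uniform bound for the multiplier √(2π) 𝓕 F. Since f is integrable it is finite, and L²
  -- convergence of the truncated transfer functions is enough to remove the error term.
  set C : ℝ := (∫ x, ‖F x‖) * Real.sqrt (2 * Real.pi) with hC
  have hC0 : 0 ≤ C := mul_nonneg (integral_nonneg fun _ => norm_nonneg _) (Real.sqrt_nonneg _)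
  have hpi : 1 ≤ 2 * Real.pi := by linarith [Real.pi_gt_three]
  have hf0 : 0 ≤ f₀ := (by positivity : (0 : ℝ) ≤ ‖h 0‖ ^ 2).trans (hb 0)
  have hmeas : ∀ A, 0 ≤ A → Continuous fun w => truncatedTransfer ψ A (2 * Real.pi * w) := by
    intro A hA
    have c1 : Continuous (𝓕 (fun x => (cutoff ψ A x : ℂ))) :=
      VectorFourier.fourierIntegral_continuous Real.continuous_fourierChar
        (by exact continuous_inner) (integrable_cutoff hψ A).ofReal
    have hne : (Real.sqrt (2 * Real.pi) : ℂ) ≠ 0 := by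
      exact_mod_cast (Real.sqrt_pos.2 (by positivity)).ne'
    have : (fun w => truncatedTransfer ψ A (2 * Real.pi * w)) =
        fun w => (Real.sqrt (2 * Real.pi) : ℂ)⁻¹ * 𝓕 (fun x => (cutoff ψ A x : ℂ)) w := by
      ext w
      rw [fourier_cutoff hA, ← mul_assoc, inv_mul_cancel₀ hne, one_mul]
    rw [this]
    fun_prop
  have hmeash : AEStronglyMeasurable (fun w => h (2 * Real.pi * w)) volume := by
    have hc0 : 2 * Real.pi ≠ 0 := by positivity
    refine hh.1.1.comp_quasiMeasurePreserving ⟨by fun_prop, ?_⟩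
    rw [Real.map_volume_mul_left hc0]
    exact Measure.smul_absolutelyContinuous
  have hstep : ∀ n : ℕ, eLpNorm (fun s => ∫ t, f t * cutoff ψ n (t + s)) 2 volume ≤
      ENNReal.ofReal C * eLpNorm (fun x => truncatedTransfer ψ n x - h x) 2 volume +
        ENNReal.ofReal (Real.sqrt (2 * Real.pi * f₀)) * eLpNorm f 2 volume := by
    intro n
    rw [(eLpNorm_correlation_cutoff hf1 hf2 hψ n.cast_nonneg).2]
    -- The bound √f₀ is known for h, not for its truncations, so the truncation error is split off.
    have hsplit : (fun w => 𝓕 F w * ((Real.sqrt (2 * Real.pi) : ℂ) *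
        truncatedTransfer ψ n (2 * Real.pi * w))) =
        (fun w => 𝓕 F w * ((Real.sqrt (2 * Real.pi) : ℂ) *
          (truncatedTransfer ψ n (2 * Real.pi * w) - h (2 * Real.pi * w)))) +
        fun w => 𝓕 F w * ((Real.sqrt (2 * Real.pi) : ℂ) * h (2 * Real.pi * w)) := by
      ext w
      simp only [Pi.add_apply]
      ring
    rw [hsplit]
    refine (eLpNorm_add_le ?_ ?_ (by norm_num)).trans (add_le_add ?_ ?_)
    · exact hFcont.aestronglyMeasurable.mul
        (((hmeas n n.cast_nonneg).aestronglyMeasurable.sub hmeash).const_mul _)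
    · exact hFcont.aestronglyMeasurable.mul (hmeash.const_mul _)
    · refine (eLpNorm_le_mul_eLpNorm_of_ae_le_mul (c := C) (g := fun w =>
        truncatedTransfer ψ n (2 * Real.pi * w) - h (2 * Real.pi * w))
        (Eventually.of_forall fun w => ?_) 2).trans ?_
      · rw [norm_mul, norm_mul, Complex.norm_real, Real.norm_of_nonneg (Real.sqrt_nonneg _), hC,
          ← mul_assoc]
        gcongr
        exact hFb w
      · gcongr
        exact eLpNorm_comp_mul_left (fun x => truncatedTransfer ψ n x - h x) hpi
    · rw [← hFnorm]
      refine eLpNorm_le_mul_eLpNorm_of_ae_le_mul (Eventually.of_forall fun w => ?_) 2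
      rw [norm_mul, norm_mul, Complex.norm_real, Real.norm_of_nonneg (Real.sqrt_nonneg _),
        mul_comm, Real.sqrt_mul (by positivity) f₀]
      gcongr
      exact Real.le_sqrt_of_sq_le (hb _)
  have hlim : ∀ s, Tendsto (fun n : ℕ => ∫ t, f t * cutoff ψ n (t + s)) atTop
      (𝓝 (∫ t, f t * ψ (t + s))) := by
    intro s
    refine tendsto_integral_of_dominated_convergence (fun t => ‖f t * ψ (t + s)‖)
      (fun n => (integrable_mul_comp_add hf2 (memLp_cutoff hψ n) s).1)
      (integrable_mul_comp_add hf2 hψ s).norm (fun n => Eventually.of_forall fun t => ?_) ?_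
    · rw [norm_mul, norm_mul]
      gcongr
      exact norm_indicator_le_norm_self _ _
    -- The cutoff lives on (0, n] and loses the value ψ 0, which matters only at the single point t
    -- = −s.
    · have : ∀ᵐ t : ℝ, t ≠ -s := by simp [ae_iff, measure_singleton]
      filter_upwards [this] with t ht
      refine Tendsto.const_mul _ (tendsto_const_nhds.congr' ?_)
      filter_upwards [tendsto_natCast_atTop_atTop.eventually_ge_atTop (t + s)] with n hn
      rcases lt_or_ge 0 (t + s) with h0 | h0
      · rw [cutoff, indicator_of_mem (show t + s ∈ Ioc (0 : ℝ) n from ⟨h0, hn⟩)]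
      · rw [cutoff, indicator_of_notMem (fun hx => absurd hx.1 (not_lt.2 h0)),
          hc _ (lt_of_le_of_ne h0 fun h' => ht (by linarith))]
  have hmK : ∀ n : ℕ, AEStronglyMeasurable (fun s => ∫ t, f t * cutoff ψ n (t + s)) volume :=
    fun n => (eLpNorm_correlation_cutoff hf1 hf2 hψ n.cast_nonneg).1
  have hmain : eLpNorm (fun s => ∫ t, f t * ψ (t + s)) 2 volume ≤
      ENNReal.ofReal (Real.sqrt (2 * Real.pi * f₀)) * eLpNorm f 2 volume := by
    refine (Lp.eLpNorm_lim_le_liminf_eLpNorm hmK _ (Eventually.of_forall hlim)).trans ?_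
    refine (liminf_le_liminf (Eventually.of_forall hstep)).trans ?_
    refine le_of_eq (Tendsto.liminf_eq ?_)
    have h1 := hh.2.comp tendsto_natCast_atTop_atTop
    have h2 := ENNReal.Tendsto.const_mul (a := ENNReal.ofReal C) h1 (Or.inr ENNReal.ofReal_ne_top)
    simpa using h2.add (tendsto_const_nhds (x :=
      ENNReal.ofReal (Real.sqrt (2 * Real.pi * f₀)) * eLpNorm f 2 volume))
  have hm : AEStronglyMeasurable (fun s => ∫ t, f t * ψ (t + s)) volume :=
    aestronglyMeasurable_of_tendsto_ae atTop hmK (Eventually.of_forall hlim)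
  rw [← eLpNorm_comp_measurePreserving hm (Measure.measurePreserving_neg volume)] at hmain
  simpa [Function.comp_def, sub_eq_add_neg] using hmain

/-! ### Second moments and mean-square integrals -/

theorem eLpNorm_two_sq {α : Type*} [MeasurableSpace α] {μ : Measure α} {f : α → ℝ}
    (hf : MemLp f 2 μ) : eLpNorm f 2 μ ^ 2 = ENNReal.ofReal (∫ x, f x ^ 2 ∂μ) := by
  have h := eLpNorm_nnreal_pow_eq_lintegral (f := f) (μ := μ) (p := 2) two_ne_zero
  rw [ofReal_integral_eq_lintegral_ofReal hf.integrable_sq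
    (Eventually.of_forall fun _ => sq_nonneg _)]
  simp only [NNReal.coe_ofNat, ENNReal.rpow_ofNat, ENNReal.coe_ofNat] at h
  rw [h]
  congr 1
  ext x
  rw [Real.enorm_eq_ofReal_abs, ← ENNReal.ofReal_pow (abs_nonneg _), sq_abs]

theorem integral_sq_eq_toReal_eLpNorm {α : Type*} [MeasurableSpace α] {μ : Measure α}
    {f : α → ℝ} (hf : MemLp f 2 μ) : ∫ x, f x ^ 2 ∂μ = (eLpNorm f 2 μ).toReal ^ 2 := by
  rw [← ENNReal.toReal_pow, eLpNorm_two_sq hf,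
    ENNReal.toReal_ofReal (integral_nonneg fun _ => sq_nonneg _)]

theorem tendsto_eLpNorm_of_tendsto_sub {α : Type*} [MeasurableSpace α] {μ : Measure α}
    {f : α → ℝ} {g : ℕ → α → ℝ} (hf : MemLp f 2 μ) (hg : ∀ n, AEStronglyMeasurable (g n) μ)
    (h : Tendsto (fun n => eLpNorm (fun x => f x - g n x) 2 μ) atTop (𝓝 0)) :
    Tendsto (fun n => eLpNorm (g n) 2 μ) atTop (𝓝 (eLpNorm f 2 μ)) := by
  have lo : Tendsto (fun n => eLpNorm f 2 μ - eLpNorm (fun x => f x - g n x) 2 μ) atTop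
      (𝓝 (eLpNorm f 2 μ)) := by
    simpa using ENNReal.Tendsto.sub tendsto_const_nhds h (Or.inl hf.2.ne)
  have hi : Tendsto (fun n => eLpNorm f 2 μ + eLpNorm (fun x => f x - g n x) 2 μ) atTop
      (𝓝 (eLpNorm f 2 μ)) := by simpa using (tendsto_const_nhds (x := eLpNorm f 2 μ)).add h
  refine tendsto_of_tendsto_of_tendsto_of_le_of_le lo hi (fun n => ?_) (fun n => ?_)
  · refine tsub_le_iff_right.2 ?_
    have := eLpNorm_add_le (hg n) (hf.1.sub (hg n)) (p := 2) (by norm_num)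
    refine le_trans (le_of_eq ?_) this
    congr 1; ext x; simp
  · have := eLpNorm_sub_le hf.1 (hf.1.sub (hg n)) (p := 2) (by norm_num)
    refine le_trans (le_of_eq ?_) this
    congr 1; ext x; simp

/-- Fatou's lemma for exponential moments. -/
theorem lintegral_exp_le_of_tendsto {Ω : Type*} [MeasurableSpace Ω] {P : Measure Ω}
    {Y : Ω → ℝ} {Z : ℕ → Ω → ℝ} {v : ℝ} {w : ℕ → ℝ} (hZ : ∀ n, AEMeasurable (Z n) P)
    (hlim : ∀ᵐ ω ∂P, Tendsto (fun n => Z n ω) atTop (𝓝 (Y ω)))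
    (hb : ∀ n, ∫⁻ ω, ENNReal.ofReal (Real.exp (Z n ω)) ∂P ≤ ENNReal.ofReal (Real.exp (w n)))
    (hw : Tendsto w atTop (𝓝 v)) :
    ∫⁻ ω, ENNReal.ofReal (Real.exp (Y ω)) ∂P ≤ ENNReal.ofReal (Real.exp v) := by
  have hc : Continuous fun x : ℝ => ENNReal.ofReal (Real.exp x) :=
    ENNReal.continuous_ofReal.comp Real.continuous_exp
  calc ∫⁻ ω, ENNReal.ofReal (Real.exp (Y ω)) ∂P
      = ∫⁻ ω, liminf (fun n => ENNReal.ofReal (Real.exp (Z n ω))) atTop ∂P := by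
        refine lintegral_congr_ae ?_
        filter_upwards [hlim] with ω hω
        exact (((hc.tendsto _).comp hω).liminf_eq).symm
    _ ≤ liminf (fun n => ∫⁻ ω, ENNReal.ofReal (Real.exp (Z n ω)) ∂P) atTop :=
        lintegral_liminf_le' fun n => hc.measurable.comp_aemeasurable (hZ n)
    _ ≤ liminf (fun n => ENNReal.ofReal (Real.exp (w n))) atTop :=
        liminf_le_liminf (Eventually.of_forall hb)
    _ = ENNReal.ofReal (Real.exp v) := ((hc.tendsto _).comp hw).liminf_eq

/-! ### Elementary and mean-square integrals: isometry, exponential moments, linearity. -/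

section WhiteNoise

variable {Ω : Type*} [MeasurableSpace Ω] {P : Measure Ω} {ξ : ℝ → Ω → ℝ}

theorem IsStrictlySubGaussian.lintegral_exp_le {n : ℕ} {X : Fin n → Ω → ℝ}
    (h : IsStrictlySubGaussian P X) (h2 : ∀ i, MemLp (X i) 2 P) (Δ : Fin n → ℝ) :
    ∫⁻ ω, ENNReal.ofReal (Real.exp (∑ i, X i ω * Δ i)) ∂P ≤
      ENNReal.ofReal (Real.exp ((1 / 2) * ∫ ω, (∑ i, X i ω * Δ i) ^ 2 ∂P)) := by
  rw [← ofReal_integral_eq_lintegral_ofReal (h.2 Δ).1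
    (Eventually.of_forall fun _ => (Real.exp_pos _).le)]
  refine ENNReal.ofReal_le_ofReal ((h.2 Δ).2.trans (le_of_eq ?_))
  have e : ∀ ω, (∑ i, X i ω * Δ i) ^ 2 = ∑ i, ∑ j, X i ω * X j ω * Δ i * Δ j := by
    intro ω
    rw [pow_two, Finset.sum_mul_sum]
    exact Finset.sum_congr rfl fun i _ => Finset.sum_congr rfl fun j _ => by ring
  have hi : ∀ i j, Integrable (fun ω => X i ω * X j ω * Δ i * Δ j) P := fun i j =>
    (((h2 i).integrable_mul (h2 j)).mul_const _).mul_const _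
  simp_rw [e]
  rw [integral_finsetSum _ fun i _ => integrable_finsetSum _ fun j _ => hi i j]
  congr 2
  refine Finset.sum_congr rfl fun i _ => ?_
  rw [integral_finsetSum _ fun j _ => hi i j]
  refine Finset.sum_congr rfl fun j _ => ?_
  rw [integral_mul_const, integral_mul_const]

theorem IsSubGaussianIntegratedWhiteNoise.integral_sub_sq
    (h : IsSubGaussianIntegratedWhiteNoise P ξ) (s t : ℝ) :
    ∫ ω, (ξ s ω - ξ t ω) ^ 2 ∂P = |s - t| := by
  rcases lt_trichotomy s t with hst | rfl | hst
  · have := h.incrementVariance s (t - s) (sub_pos.2 hst)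
    simp only [add_sub_cancel, sq_abs] at this
    rw [abs_of_neg (sub_neg.2 hst), neg_sub, ← this]
    congr 1; ext ω; ring
  · simp
  · have := h.incrementVariance t (s - t) (sub_pos.2 hst)
    simp only [add_sub_cancel, sq_abs] at this
    rw [abs_of_pos (sub_pos.2 hst), ← this]

/-- The overlap length of two intervals, in the shape that polarization of increments produces. -/
theorem integral_indicator_Ico_mul {a b a' b' : ℝ} (hab : a ≤ b) (hab' : a' ≤ b') :
    ∫ s, (Ico a b).indicator (fun _ => (1 : ℝ)) s * (Ico a' b').indicator (fun _ => (1 : ℝ)) s =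
      (|b - a'| + |a - b'| - |b - b'| - |a - a'|) / 2 := by
  have e : (fun s => (Ico a b).indicator (fun _ => (1 : ℝ)) s *
      (Ico a' b').indicator (fun _ => (1 : ℝ)) s) =
      (Ico (max a a') (min b b')).indicator (fun _ => (1 : ℝ)) := by
    rw [← Ico_inter_Ico]
    ext s
    simp [indicator_apply, ← ite_and, and_comm]
  rw [e, integral_indicator measurableSet_Ico]
  simp only [integral_const, smul_eq_mul, mul_one, measureReal_restrict_apply_univ,
    Real.volume_real_Ico]
  rcases le_total a a' with h1 | h1 <;> rcases le_total b b' with h2 | h2 <;>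
  rcases le_total b a' with h3 | h3 <;> rcases le_total a b' with h4 | h4 <;>
  simp only [max_eq_right, max_eq_left, min_eq_left, min_eq_right, h1, h2, sub_nonneg, sub_nonpos,
    h3, h4,
    abs_of_nonneg, abs_of_nonpos, hab, hab'] <;> linarith

/-- By polarization, 2(b − a)(b' − a') = (b − a')² + (a − b')² − (b − b')² − (a − a')², read with
the values of ξ; the covariance thus reduces to variances |s − t|. -/
theorem IsSubGaussianIntegratedWhiteNoise.integral_increment_mul
    (h : IsSubGaussianIntegratedWhiteNoise P ξ) {a b a' b' : ℝ} (hab : a ≤ b) (hab' : a' ≤ b') :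
    ∫ ω, (ξ b ω - ξ a ω) * (ξ b' ω - ξ a' ω) ∂P =
      ∫ s, (Ico a b).indicator (fun _ => (1 : ℝ)) s *
        (Ico a' b').indicator (fun _ => (1 : ℝ)) s := by
  rw [integral_indicator_Ico_mul hab hab', ← h.integral_sub_sq b a', ← h.integral_sub_sq a b',
    ← h.integral_sub_sq b b', ← h.integral_sub_sq a a']
  have hi : ∀ s t, Integrable (fun ω => (ξ s ω - ξ t ω) ^ 2) P := fun s t =>
    ((h.meanSquareContinuous.1 s).sub (h.meanSquareContinuous.1 t)).integrable_sq
  have i1 : Integrable (fun ω => (ξ b ω - ξ a' ω) ^ 2 + (ξ a ω - ξ b' ω) ^ 2) P :=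
    (hi _ _).add (hi _ _)
  have i2 : Integrable (fun ω => (ξ b ω - ξ a' ω) ^ 2 + (ξ a ω - ξ b' ω) ^ 2 -
    (ξ b ω - ξ b' ω) ^ 2) P := i1.sub (hi _ _)
  rw [← integral_add (hi _ _) (hi _ _), ← integral_sub i1 (hi _ _), ← integral_sub i2 (hi _ _),
    ← integral_div]
  congr 1; ext ω; ring

theorem StepFunction.memLp_eval (S : StepFunction) : MemLp S.eval 2 volume :=
  memLp_finsetSum _ fun _ _ =>
    (memLp_indicator_const 2 measurableSet_Ico (1 : ℝ) (Or.inr (by simp))).const_mul _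

theorem StepFunction.memLp_integral (S : StepFunction) (h : ∀ t, MemLp (ξ t) 2 P) :
    MemLp (S.integral ξ) 2 P :=
  memLp_finsetSum _ fun _ _ => ((h _).sub (h _)).const_mul _

theorem IsSubGaussianIntegratedWhiteNoise.integral_step_sq
    (h : IsSubGaussianIntegratedWhiteNoise P ξ) (S : StepFunction) :
    ∫ ω, S.integral ξ ω ^ 2 ∂P = ∫ s, S.eval s ^ 2 := by
  have e1 : ∀ ω, S.integral ξ ω ^ 2 = ∑ l, ∑ m, S.c l * S.c m *
      ((ξ (S.β l) ω - ξ (S.α l) ω) * (ξ (S.β m) ω - ξ (S.α m) ω)) := by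
    intro ω
    rw [StepFunction.integral, pow_two, Finset.sum_mul_sum]
    exact Finset.sum_congr rfl fun i _ => Finset.sum_congr rfl fun j _ => by ring
  have e2 : ∀ s, S.eval s ^ 2 = ∑ l, ∑ m, S.c l * S.c m *
      ((Ico (S.α l) (S.β l)).indicator (fun _ => (1 : ℝ)) s *
        (Ico (S.α m) (S.β m)).indicator (fun _ => (1 : ℝ)) s) := by
    intro ω
    rw [StepFunction.eval, pow_two, Finset.sum_mul_sum]
    exact Finset.sum_congr rfl fun i _ => Finset.sum_congr rfl fun j _ => by ring
  have i1 : ∀ l m, Integrable (fun ω => S.c l * S.c m *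
      ((ξ (S.β l) ω - ξ (S.α l) ω) * (ξ (S.β m) ω - ξ (S.α m) ω))) P := fun l m =>
    (((h.meanSquareContinuous.1 _).sub (h.meanSquareContinuous.1 _)).integrable_mul
      ((h.meanSquareContinuous.1 _).sub (h.meanSquareContinuous.1 _))).const_mul _
  have hI : ∀ l, MemLp ((Ico (S.α l) (S.β l)).indicator fun _ => (1 : ℝ)) 2 volume := fun l =>
    memLp_indicator_const 2 measurableSet_Ico (1 : ℝ) (Or.inr (by simp))
  have i2 : ∀ l m, Integrable (fun s => S.c l * S.c m *
      ((Ico (S.α l) (S.β l)).indicator (fun _ => (1 : ℝ)) s *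
        (Ico (S.α m) (S.β m)).indicator (fun _ => (1 : ℝ)) s)) := fun l m =>
    ((hI l).integrable_mul (hI m)).const_mul _
  simp_rw [e1, e2]
  rw [integral_finsetSum _ fun i _ => integrable_finsetSum _ fun j _ => i1 i j,
    integral_finsetSum _ fun i _ => integrable_finsetSum _ fun j _ => i2 i j]
  refine Finset.sum_congr rfl fun l _ => ?_
  rw [integral_finsetSum _ fun j _ => i1 l j, integral_finsetSum _ fun j _ => i2 l j]
  refine Finset.sum_congr rfl fun m _ => ?_
  rw [integral_const_mul, integral_const_mul, h.integral_increment_mul (S.le l) (S.le m)]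

theorem IsSubGaussianIntegratedWhiteNoise.eLpNorm_step
    (h : IsSubGaussianIntegratedWhiteNoise P ξ) (S : StepFunction) :
    eLpNorm (S.integral ξ) 2 P = eLpNorm S.eval 2 volume := by
  have := h.integral_step_sq S
  have h1 := eLpNorm_two_sq (S.memLp_integral h.meanSquareContinuous.1)
  rw [this, ← eLpNorm_two_sq S.memLp_eval] at h1
  exact (ENNReal.pow_right_strictMono two_ne_zero).injective h1

/-- The elementary integral is a linear form in the values of ξ at all endpoints, with coefficients
c at right ends and −c at left ends, so strict sub-Gaussianity applies; the isometry identifies its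
second moment. -/
theorem IsSubGaussianIntegratedWhiteNoise.lintegral_exp_step_le
    (h : IsSubGaussianIntegratedWhiteNoise P ξ) (S : StepFunction) :
    ∫⁻ ω, ENNReal.ofReal (Real.exp (S.integral ξ ω)) ∂P ≤
      ENNReal.ofReal (Real.exp ((1 / 2) * (eLpNorm S.eval 2 volume).toReal ^ 2)) := by
  rw [← integral_sq_eq_toReal_eLpNorm S.memLp_eval, ← h.integral_step_sq S]
  have key := (h.subGaussian (S.n + S.n) (Fin.append S.β S.α)).lintegral_exp_le
    (fun i => h.meanSquareContinuous.1 _) (Fin.append S.c (fun l => -S.c l))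
  have e : ∀ ω, ∑ i, ξ (Fin.append S.β S.α i) ω * Fin.append S.c (fun l => -S.c l) i =
      S.integral ξ ω := by
    intro ω
    rw [Fin.sum_univ_add, StepFunction.integral, ← Finset.sum_add_distrib]
    refine Finset.sum_congr rfl fun l _ => ?_
    simp only [Fin.append_left, Fin.append_right]
    ring
  simpa only [e] using key

theorem IsMeanSquareIntegral.eLpNorm_eq (h : IsSubGaussianIntegratedWhiteNoise P ξ)
    {φ : ℝ → ℝ} {Y : Ω → ℝ} (hφ : MemLp φ 2 volume) (hY : MemLp Y 2 P)
    (hi : IsMeanSquareIntegral P ξ φ Y) : eLpNorm Y 2 P = eLpNorm φ 2 volume := by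
  obtain ⟨S, h1, h2⟩ := hi
  have t1 := tendsto_eLpNorm_of_tendsto_sub hφ (fun n => (S n).memLp_eval.1) h1
  have t2 := tendsto_eLpNorm_of_tendsto_sub hY
    (fun n => ((S n).memLp_integral h.meanSquareContinuous.1).1) h2
  simp only [h.eLpNorm_step] at t2
  exact tendsto_nhds_unique t2 t1

/-- Mean-square convergence gives an almost surely convergent subsequence, along which the L² norms
of the step functions converge too; Fatou concludes. -/
theorem IsMeanSquareIntegral.lintegral_exp_le (h : IsSubGaussianIntegratedWhiteNoise P ξ)
    {φ : ℝ → ℝ} {Y : Ω → ℝ} (hφ : MemLp φ 2 volume) (hY : AEStronglyMeasurable Y P)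
    (hi : IsMeanSquareIntegral P ξ φ Y) :
    ∫⁻ ω, ENNReal.ofReal (Real.exp (Y ω)) ∂P ≤
      ENNReal.ofReal (Real.exp ((1 / 2) * (eLpNorm φ 2 volume).toReal ^ 2)) := by
  obtain ⟨S, h1, h2⟩ := hi
  have hm : ∀ n, AEStronglyMeasurable ((S n).integral ξ) P :=
    fun n => ((S n).memLp_integral h.meanSquareContinuous.1).1
  have hconv : TendstoInMeasure P (fun n => (S n).integral ξ) atTop Y := by
    refine tendstoInMeasure_of_tendsto_eLpNorm (p := 2) two_ne_zero hm hY ?_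
    refine h2.congr fun n => ?_
    rw [← eLpNorm_neg]
    congr 1; ext ω; simp
  obtain ⟨ns, hns, hae⟩ := hconv.exists_seq_tendsto_ae
  have t1 := (tendsto_eLpNorm_of_tendsto_sub hφ (fun n => (S n).memLp_eval.1) h1).comp
    hns.tendsto_atTop
  have t2 := (ENNReal.tendsto_toReal hφ.2.ne).comp t1
  exact lintegral_exp_le_of_tendsto (fun n => (hm (ns n)).aemeasurable) hae
    (fun n => h.lintegral_exp_step_le (S (ns n))) ((t2.pow 2).const_mul (1 / 2))

/-- The sum of two step functions. -/
noncomputable def StepFunction.add (S S' : StepFunction) : StepFunction where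
  n := S.n + S'.n
  c := Fin.append S.c S'.c
  α := Fin.append S.α S'.α
  β := Fin.append S.β S'.β
  le := Fin.addCases (fun l => by simpa using S.le l) (fun l => by simpa using S'.le l)

/-- A multiple of a step function. -/
noncomputable def StepFunction.smul (r : ℝ) (S : StepFunction) : StepFunction where
  n := S.n
  c := fun l => r * S.c l
  α := S.α
  β := S.β
  le := S.le

theorem StepFunction.eval_add (S S' : StepFunction) (s : ℝ) :
    (S.add S').eval s = S.eval s + S'.eval s := by
  refine (Fin.sum_univ_add _).trans ?_
  simp [StepFunction.eval, StepFunction.add]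

theorem StepFunction.integral_add {Ω : Type*} (S S' : StepFunction) (ξ : ℝ → Ω → ℝ) (ω : Ω) :
    (S.add S').integral ξ ω = S.integral ξ ω + S'.integral ξ ω := by
  refine (Fin.sum_univ_add _).trans ?_
  simp [StepFunction.integral, StepFunction.add]

theorem StepFunction.eval_smul (r : ℝ) (S : StepFunction) (s : ℝ) :
    (S.smul r).eval s = r * S.eval s := by
  simp only [StepFunction.eval, StepFunction.smul, Finset.mul_sum, mul_assoc]
  rfl

theorem StepFunction.integral_smul {Ω : Type*} (r : ℝ) (S : StepFunction) (ξ : ℝ → Ω → ℝ) (ω : Ω) :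
    (S.smul r).integral ξ ω = r * S.integral ξ ω := by
  simp only [StepFunction.integral, StepFunction.smul, Finset.mul_sum, mul_assoc]
  rfl

theorem IsMeanSquareIntegral.zero : IsMeanSquareIntegral P ξ (fun _ => 0) (fun _ => 0) := by
  refine ⟨fun _ => ⟨0, Fin.elim0, Fin.elim0, Fin.elim0, fun l => l.elim0⟩, ?_, ?_⟩ <;>
  simp [StepFunction.eval, StepFunction.integral]

theorem IsMeanSquareIntegral.add (h : ∀ t, MemLp (ξ t) 2 P) {φ φ' : ℝ → ℝ} {Y Y' : Ω → ℝ}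
    (hφ : AEStronglyMeasurable φ volume) (hφ' : AEStronglyMeasurable φ' volume)
    (hY : AEStronglyMeasurable Y P) (hY' : AEStronglyMeasurable Y' P)
    (hi : IsMeanSquareIntegral P ξ φ Y) (hi' : IsMeanSquareIntegral P ξ φ' Y') :
    IsMeanSquareIntegral P ξ (fun s => φ s + φ' s) (fun ω => Y ω + Y' ω) := by
  obtain ⟨S, h1, h2⟩ := hi
  obtain ⟨S', h1', h2'⟩ := hi'
  refine ⟨fun n => (S n).add (S' n), ?_, ?_⟩
  · refine tendsto_of_tendsto_of_tendsto_of_le_of_le tendsto_const_nhds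
      (by simpa using h1.add h1') (fun _ => zero_le) fun n => ?_
    refine le_trans (le_of_eq ?_) (eLpNorm_add_le (hφ.sub (S n).memLp_eval.1)
      (hφ'.sub (S' n).memLp_eval.1) (by norm_num))
    congr 1; ext s
    simp only [StepFunction.eval_add, Pi.add_apply]
    ring
  · refine tendsto_of_tendsto_of_tendsto_of_le_of_le tendsto_const_nhds
      (by simpa using h2.add h2') (fun _ => zero_le) fun n => ?_
    refine le_trans (le_of_eq ?_) (eLpNorm_add_le (hY.sub ((S n).memLp_integral h).1)
      (hY'.sub ((S' n).memLp_integral h).1) (by norm_num))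
    congr 1; ext s
    simp only [StepFunction.integral_add, Pi.add_apply]
    ring

theorem IsMeanSquareIntegral.const_mul {φ : ℝ → ℝ} {Y : Ω → ℝ}
    (hi : IsMeanSquareIntegral P ξ φ Y) (r : ℝ) :
    IsMeanSquareIntegral P ξ (fun s => r * φ s) (fun ω => r * Y ω) := by
  obtain ⟨S, h1, h2⟩ := hi
  refine ⟨fun n => (S n).smul r, ?_, ?_⟩
  · have := ENNReal.Tendsto.const_mul (a := ‖r‖ₑ) h1 (Or.inr (by simp))
    rw [mul_zero] at this
    refine this.congr fun n => ?_
    rw [← eLpNorm_const_smul]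
    congr 1; ext s
    simp only [StepFunction.eval_smul, Pi.smul_apply, smul_eq_mul]
    ring
  · have := ENNReal.Tendsto.const_mul (a := ‖r‖ₑ) h2 (Or.inr (by simp))
    rw [mul_zero] at this
    refine this.congr fun n => ?_
    rw [← eLpNorm_const_smul]
    congr 1; ext s
    simp only [StepFunction.integral_smul, Pi.smul_apply, smul_eq_mul]
    ring

/-- Needed for finite combinations of values of ε, whose kernels are the same combinations of
shifted filters. -/
theorem IsMeanSquareIntegral.sum (h : ∀ t, MemLp (ξ t) 2 P) {ι : Type*} (A : Finset ι)
    {φ : ι → ℝ → ℝ} {Y : ι → Ω → ℝ} (hφ : ∀ i ∈ A, AEStronglyMeasurable (φ i) volume)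
    (hY : ∀ i ∈ A, AEStronglyMeasurable (Y i) P)
    (hi : ∀ i ∈ A, IsMeanSquareIntegral P ξ (φ i) (Y i)) :
    IsMeanSquareIntegral P ξ (fun s => ∑ i ∈ A, φ i s) (fun ω => ∑ i ∈ A, Y i ω) := by
  classical
  induction A using Finset.induction_on with
  | empty => simpa using IsMeanSquareIntegral.zero
  | insert i A hiA ih =>
    simp only [Finset.sum_insert hiA]
    simp only [Finset.forall_mem_insert] at hφ hY hi
    exact IsMeanSquareIntegral.add h hφ.1 (Finset.aestronglyMeasurable_fun_sum _ hφ.2) hY.1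
      (Finset.aestronglyMeasurable_fun_sum _ hY.2) hi.1 (ih hφ.2 hY.2 hi.2)

theorem IsMeanSquareIntegral.congr_kernel {φ φ' : ℝ → ℝ} {Y : Ω → ℝ} (hφ : φ =ᵐ[volume] φ')
    (hi : IsMeanSquareIntegral P ξ φ Y) : IsMeanSquareIntegral P ξ φ' Y := by
  obtain ⟨S, h1, h2⟩ := hi
  refine ⟨S, h1.congr fun n => eLpNorm_congr_ae ?_, h2⟩
  filter_upwards [hφ] with s hs
  rw [hs]

end WhiteNoise

/-! ### Weighted integrals of the noise are sub-Gaussian -/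

/-- Sampling at a simple function of t leaves finitely many values of Z. Applied with Z a path of ε
and with Z a slice of the filter, it yields the same coefficients for both. -/
theorem integral_mul_comp_simpleFunc (r : SimpleFunc ℝ ℝ) {f : ℝ → ℝ} (hf : Integrable f)
    (Z : ℝ → ℝ) :
    ∫ t, f t * Z (r t) = ∑ x ∈ r.range, (∫ t in r ⁻¹' {x}, f t) * Z x := by
  have e : ∀ t, f t * Z (r t) = ∑ x ∈ r.range, (r ⁻¹' {x}).indicator f t * Z x := by
    intro t
    rw [Finset.sum_eq_single (r t)]
    · rw [indicator_of_mem (by simp)]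
    · intro x _ hx
      rw [indicator_of_notMem (by simpa using hx.symm), zero_mul]
    · intro h
      exact absurd (r.mem_range_self t) h
  simp_rw [e]
  rw [integral_finsetSum _ fun x _ => (hf.indicator (r.measurableSet_fiber x)).mul_const _]
  refine Finset.sum_congr rfl fun x _ => ?_
  rw [integral_mul_const, integral_indicator (r.measurableSet_fiber x)]

/-- Cauchy--Schwarz for a kernel operator with weight `f` carried by a set `A`. -/
theorem eLpNorm_integral_mul_sq_le {f : ℝ → ℝ} {k : ℝ → ℝ → ℝ} {A : Set ℝ}
    (hA : MeasurableSet A) (hf : AEMeasurable f volume) (hsupp : ∀ t ∉ A, f t = 0)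
    (hk : Measurable (Function.uncurry k)) :
    eLpNorm (fun s => ∫ t, f t * k t s) 2 volume ^ 2 ≤
      (∫⁻ t, ‖f t‖ₑ ^ 2) * ∫⁻ t in A, eLpNorm (k t) 2 volume ^ 2 := by
  have h2 : ∀ g : ℝ → ℝ, eLpNorm g 2 volume ^ 2 = ∫⁻ s, ‖g s‖ₑ ^ 2 := by
    intro g
    have h := eLpNorm_nnreal_pow_eq_lintegral (f := g) (μ := volume) (p := 2) two_ne_zero
    simpa only [NNReal.coe_ofNat, ENNReal.rpow_ofNat, ENNReal.coe_ofNat] using h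
  have hks : ∀ s, Measurable fun t => k t s := fun s => hk.comp (measurable_id.prodMk measurable_const)
  simp_rw [h2]
  have hk2 : Measurable fun p : ℝ × ℝ => ‖k p.2 p.1‖ₑ ^ 2 :=
    ((hk.comp measurable_swap).enorm).pow_const 2
  rw [lintegral_lintegral_swap (by exact (hk2.comp measurable_swap).aemeasurable),
    ← lintegral_const_mul _ (by exact hk2.lintegral_prod_right')]
  refine lintegral_mono fun s => ?_
  have e : ∫⁻ t, ‖f t * k t s‖ₑ = ∫⁻ t in A, ‖f t‖ₑ * ‖k t s‖ₑ := by
    rw [← lintegral_indicator hA]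
    congr 1
    ext t
    by_cases ht : t ∈ A
    · simp [indicator_of_mem ht, enorm_mul]
    · simp [indicator_of_notMem ht, hsupp t ht]
  calc ‖∫ t, f t * k t s‖ₑ ^ 2 ≤ (∫⁻ t, ‖f t * k t s‖ₑ) ^ 2 := by
        gcongr
        exact enorm_integral_le_lintegral_enorm _
    _ = (∫⁻ t in A, ‖f t‖ₑ * ‖k t s‖ₑ) ^ 2 := by rw [e]
    _ ≤ ((∫⁻ t in A, ‖f t‖ₑ ^ (2 : ℝ)) ^ (1 / 2 : ℝ) *
          (∫⁻ t in A, ‖k t s‖ₑ ^ (2 : ℝ)) ^ (1 / 2 : ℝ)) ^ 2 := by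
        gcongr
        exact ENNReal.lintegral_mul_le_Lp_mul_Lq _ Real.HolderConjugate.two_two
          hf.enorm.restrict (hks s).enorm.aemeasurable
    _ = (∫⁻ t in A, ‖f t‖ₑ ^ 2) * ∫⁻ t in A, ‖k t s‖ₑ ^ 2 := by
        rw [mul_pow, ← ENNReal.rpow_natCast, ← ENNReal.rpow_natCast, ← ENNReal.rpow_mul,
          ← ENNReal.rpow_mul]
        norm_num
    _ ≤ (∫⁻ t, ‖f t‖ₑ ^ 2) * ∫⁻ t in A, ‖k t s‖ₑ ^ 2 := by
        gcongr
        exact Measure.restrict_le_self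

section Noise

variable {Ω : Type*} [MeasurableSpace Ω] {P : Measure Ω} {ξ ε : ℝ → Ω → ℝ} {ψ : ℝ → ℝ}

/-- The filter of a filtered noise may be taken Borel measurable. -/
theorem IsFilteredNoise.exists_measurable (h : IsFilteredNoise P ξ ψ ε) :
    ∃ ψ' : ℝ → ℝ, Measurable ψ' ∧ ψ' =ᵐ[volume] ψ ∧ IsFilteredNoise P ξ ψ' ε := by
  obtain ⟨m, hm, hae⟩ := h.squareIntegrable.1.aemeasurable
  -- Cutting to t ≥ 0 restores causality at every point, not only almost everywhere.
  have hae' : (Ici (0 : ℝ)).indicator m =ᵐ[volume] ψ := by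
    filter_upwards [hae] with t ht
    by_cases h0 : t ∈ Ici (0 : ℝ)
    · rw [indicator_of_mem h0, ht]
    · rw [indicator_of_notMem h0, h.causal t (not_le.1 h0)]
  refine ⟨(Ici (0 : ℝ)).indicator m, hm.indicator measurableSet_Ici, hae', h.driver,
    fun t ht => indicator_of_notMem (not_le.2 ht) _,
    (memLp_congr_ae hae').2 h.squareIntegrable, fun t => ?_⟩
  refine IsMeanSquareIntegral.congr_kernel ?_ (h.representation t)
  exact (Measure.measurePreserving_sub_left volume t).quasiMeasurePreserving.ae_eq_comp hae'.symm

theorem IsTransferFunction.congr {ψ ψ' : ℝ → ℝ} {h : ℝ → ℂ} (hψ : ψ' =ᵐ[volume] ψ)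
    (hh : IsTransferFunction ψ h) : IsTransferFunction ψ' h := by
  refine ⟨hh.1, hh.2.congr fun A => ?_⟩
  congr 1
  ext x
  simp only [truncatedTransfer]
  congr 2
  refine intervalIntegral.integral_congr_ae ?_
  filter_upwards [hψ] with t ht _
  rw [ht]

theorem IsFilteredNoise.memLp_shift (h : IsFilteredNoise P ξ ψ ε) (t : ℝ) :
    MemLp (fun s => ψ (t - s)) 2 volume :=
  h.squareIntegrable.comp_measurePreserving (Measure.measurePreserving_sub_left volume t)

/-- By the isometry, translates of the filter are as continuous in L² as the noise is in mean
square. -/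
theorem IsFilteredNoise.eLpNorm_shift_sub (h : IsFilteredNoise P ξ ψ ε)
    (hε : IsContinuousCenteredNoise P ε) (a b : ℝ) :
    eLpNorm (fun s => ψ (a - s) - ψ (b - s)) 2 volume = eLpNorm (fun ω => ε a ω - ε b ω) 2 P := by
  have ha := h.memLp_shift a
  have hb := h.memLp_shift b
  have ea := hε.meanSquareContinuous.1 a
  have eb := hε.meanSquareContinuous.1 b
  have := (h.representation a).add h.driver.meanSquareContinuous.1 ha.1 (hb.1.const_mul (-1))
    ea.1 (eb.1.const_mul (-1)) ((h.representation b).const_mul (-1))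
  simp only [neg_one_mul, ← sub_eq_add_neg] at this
  exact (this.eLpNorm_eq h.driver (ha.sub hb) (ea.sub eb)).symm

theorem IsFilteredNoise.tendsto_eLpNorm_shift_sub (h : IsFilteredNoise P ξ ψ ε)
    (hε : IsContinuousCenteredNoise P ε) {x : ℕ → ℝ} {t : ℝ} (hx : Tendsto x atTop (𝓝 t)) :
    Tendsto (fun n => eLpNorm (fun s => ψ (t - s) - ψ (x n - s)) 2 volume ^ 2) atTop (𝓝 0) := by
  have h1 := (ENNReal.continuous_ofReal.tendsto _).comp
    ((hε.meanSquareContinuous.2 t).comp hx)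
  rw [ENNReal.ofReal_zero] at h1
  refine h1.congr fun n => ?_
  rw [h.eLpNorm_shift_sub hε]
  refine Eq.trans ?_ (eLpNorm_two_sq
    ((hε.meanSquareContinuous.1 t).sub (hε.meanSquareContinuous.1 (x n)))).symm
  simp only [Function.comp_apply, Pi.sub_apply]
  congr 2
  ext ω
  ring

/-- The exponential moment of `∫ f t * ε t dt` for a square integrable weight `f` supported
in `[0, T]`, when the spectral density of the noise is bounded by `f₀`. -/
theorem IsFilteredNoise.lintegral_exp_integral_mul_le (h : IsFilteredNoise P ξ ψ ε)
    (hε : IsContinuousCenteredNoise P ε) {g : ℝ → ℂ} {f₀ : ℝ} (hg : IsTransferFunction ψ g)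
    (hb : ∀ x, ‖g x‖ ^ 2 ≤ f₀) {f : ℝ → ℝ} {T : ℝ} (hT : 0 ≤ T) (hf : MemLp f 2 volume)
    (hsupp : ∀ t ∉ Icc 0 T, f t = 0) :
    AEMeasurable (fun ω => ∫ t, f t * ε t ω) P ∧
    ∫⁻ ω, ENNReal.ofReal (Real.exp (∫ t, f t * ε t ω)) ∂P ≤
      ENNReal.ofReal (Real.exp ((1 / 2) * (2 * Real.pi * f₀ * ∫ t, f t ^ 2))) := by
  obtain ⟨ψ', hψm, hae, h'⟩ := h.exists_measurable
  replace hg := hg.congr hae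
  clear h hae
  have hf1 : Integrable f := by
    have : IntegrableOn f (Icc 0 T) := (hf.restrict _).integrable (by norm_num)
    refine (integrable_indicator_iff measurableSet_Icc).2 this |>.congr ?_
    refine Eventually.of_forall fun t => ?_
    by_cases ht : t ∈ Icc 0 T
    · simp [indicator_of_mem ht]
    · simp [indicator_of_notMem ht, hsupp t ht]
  have hid : StronglyMeasurable (id : ℝ → ℝ) := stronglyMeasurable_id
  -- Sampling times `r n t` tend to t on [0, T] and stay in [−T, T], where each continuous path is
  -- bounded. `Yn` samples the noise at them and `Kn` is its kernel.
  set r : ℕ → SimpleFunc ℝ ℝ := hid.approxBounded T with hr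
  have hrlim : ∀ t ∈ Icc 0 T, Tendsto (fun n => r n t) atTop (𝓝 t) := fun t ht =>
    hid.tendsto_approxBounded_of_norm_le (by
      simpa [abs_of_nonneg ht.1] using ht.2)
  have hrb : ∀ n t, |r n t| ≤ T := fun n t => hid.norm_approxBounded_le hT n t
  set c : ℕ → ℝ → ℝ := fun n x => ∫ t in r n ⁻¹' {x}, f t with hc
  set K : ℝ → ℝ := fun s => ∫ t, f t * ψ' (t - s) with hK
  set Kn : ℕ → ℝ → ℝ := fun n s => ∑ x ∈ (r n).range, c n x * ψ' (x - s) with hKn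
  set Y : Ω → ℝ := fun ω => ∫ t, f t * ε t ω with hY
  set Yn : ℕ → Ω → ℝ := fun n ω => ∑ x ∈ (r n).range, c n x * ε x ω with hYn
  have hKn2 : ∀ n, MemLp (Kn n) 2 volume := fun n =>
    memLp_finsetSum _ fun x _ => (h'.memLp_shift x).const_mul _
  have hYnm : ∀ n, Measurable (Yn n) := fun n =>
    Finset.measurable_sum _ fun x _ => (hε.measurable x).const_mul _
  have hYnlim : ∀ᵐ ω ∂P, Tendsto (fun n => Yn n ω) atTop (𝓝 (Y ω)) := by
    filter_upwards [hε.continuousPaths] with ω hω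
    have e : ∀ n, Yn n ω = ∫ t, f t * ε (r n t) ω := fun n =>
      (integral_mul_comp_simpleFunc (r n) hf1 fun t => ε t ω).symm
    simp_rw [e]
    obtain ⟨M, hM⟩ := (isCompact_Icc (a := -T) (b := T)).exists_bound_of_continuousOn
      hω.continuousOn
    refine tendsto_integral_of_dominated_convergence (fun t => ‖f t‖ * M) (fun n => ?_)
      (hf1.norm.mul_const M) (fun n => Eventually.of_forall fun t => ?_)
      (Eventually.of_forall fun t => ?_)
    · exact hf1.1.mul (hω.measurable.comp (r n).measurable).aestronglyMeasurable
    · rw [norm_mul]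
      gcongr
      exact hM _ (abs_le.1 (hrb n t))
    · by_cases ht : t ∈ Icc 0 T
      · exact ((hω.tendsto t).comp (hrlim t ht)).const_mul _
      · simp [hsupp t ht]
  have hKm : AEStronglyMeasurable K volume := by
    have : AEStronglyMeasurable (fun p : ℝ × ℝ => f p.2 * ψ' (p.2 - p.1))
        ((volume : Measure ℝ).prod volume) :=
      hf.1.comp_snd.mul (hψm.comp (measurable_snd.sub measurable_fst)).aestronglyMeasurable
    exact this.integral_prod_right'
  have hKle := eLpNorm_filter_le hf1 hf h'.squareIntegrable h'.causal hg hb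
  have hK2 : MemLp K 2 volume :=
    ⟨hKm, hKle.trans_lt (ENNReal.mul_lt_top ENNReal.ofReal_lt_top hf.2)⟩
  have hconv : Tendsto (fun n => eLpNorm (fun s => K s - Kn n s) 2 volume) atTop (𝓝 0) := by
    -- Cauchy–Schwarz bounds the squared error by ‖f‖² times the integral over [0, T] of the squared
    -- L² distance between the filters shifted by t and by `r n t`, which tends to zero by dominated
    -- convergence.
    have hsq : Tendsto (fun n => eLpNorm (fun s => K s - Kn n s) 2 volume ^ 2) atTop (𝓝 0) := by
      have hlim : Tendsto (fun n => ∫⁻ t in Icc 0 T,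
          eLpNorm (fun s => ψ' (t - s) - ψ' (r n t - s)) 2 volume ^ 2) atTop (𝓝 0) := by
        have hlin : ∀ n, Measurable fun t =>
            eLpNorm (fun s => ψ' (t - s) - ψ' (r n t - s)) 2 volume ^ 2 := by
          intro n
          have h2 : ∀ t, eLpNorm (fun s => ψ' (t - s) - ψ' (r n t - s)) 2 volume ^ 2 =
              ∫⁻ s, ‖ψ' (t - s) - ψ' (r n t - s)‖ₑ ^ 2 := by
            intro t
            have h := eLpNorm_nnreal_pow_eq_lintegral
              (f := fun s => ψ' (t - s) - ψ' (r n t - s)) (μ := volume) (p := 2) two_ne_zero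
            simpa only [NNReal.coe_ofNat, ENNReal.rpow_ofNat, ENNReal.coe_ofNat] using h
          simp_rw [h2]
          have : Measurable fun p : ℝ × ℝ => ‖ψ' (p.1 - p.2) - ψ' (r n p.1 - p.2)‖ₑ ^ 2 :=
            (((hψm.comp (measurable_fst.sub measurable_snd)).sub
              (hψm.comp (((r n).measurable.comp measurable_fst).sub measurable_snd))).enorm).pow_const 2
          exact this.lintegral_prod_right'
        have := tendsto_lintegral_of_dominated_convergence (μ := volume.restrict (Icc 0 T))
          (F := fun n t => eLpNorm (fun s => ψ' (t - s) - ψ' (r n t - s)) 2 volume ^ 2)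
          (f := fun _ => 0) (fun _ => (2 * eLpNorm ψ' 2 volume) ^ 2) hlin
          (fun n => Eventually.of_forall fun t => ?_) ?_ ?_
        · simpa using this
        · refine pow_le_pow_left₀ zero_le ?_ 2
          refine (eLpNorm_sub_le (h'.memLp_shift t).1 (h'.memLp_shift (r n t)).1
            (by norm_num)).trans ?_
          rw [two_mul]
          exact add_le_add
            (eLpNorm_comp_measurePreserving hψm.aestronglyMeasurable
              (Measure.measurePreserving_sub_left volume t)).le
            (eLpNorm_comp_measurePreserving hψm.aestronglyMeasurable
              (Measure.measurePreserving_sub_left volume (r n t))).le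
        · rw [lintegral_const]
          refine ENNReal.mul_ne_top (ENNReal.pow_ne_top
            (ENNReal.mul_ne_top (by norm_num) h'.squareIntegrable.2.ne)) (by simp)
        · filter_upwards [ae_restrict_mem measurableSet_Icc] with t ht
          exact h'.tendsto_eLpNorm_shift_sub hε (hrlim t ht)
      have hfin : ∫⁻ t, ‖f t‖ₑ ^ 2 ≠ ⊤ := by
        have h := eLpNorm_nnreal_pow_eq_lintegral (f := f) (μ := volume) (p := 2) two_ne_zero
        simp only [NNReal.coe_ofNat, ENNReal.rpow_ofNat, ENNReal.coe_ofNat] at h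
        rw [← h]
        exact ENNReal.pow_ne_top hf.2.ne
      have hmul := ENNReal.Tendsto.const_mul (a := ∫⁻ t, ‖f t‖ₑ ^ 2) hlim (Or.inr hfin)
      rw [mul_zero] at hmul
      refine tendsto_of_tendsto_of_tendsto_of_le_of_le tendsto_const_nhds hmul
        (fun _ => zero_le) fun n => ?_
      have e : (fun s => K s - Kn n s) =
          fun s => ∫ t, f t * (ψ' (t - s) - ψ' (r n t - s)) := by
        ext s
        have e1 : Kn n s = ∫ t, f t * ψ' (r n t - s) :=
          (integral_mul_comp_simpleFunc (r n) hf1 fun t => ψ' (t - s)).symm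
        have i1 : Integrable fun t => f t * ψ' (t - s) := by
          simpa [sub_eq_add_neg] using integrable_mul_comp_add hf h'.squareIntegrable (-s)
        have i2 : Integrable fun t => f t * ψ' (r n t - s) := by
          obtain ⟨M, hM⟩ := ((r n).map fun x => ψ' (x - s)).exists_forall_norm_le
          exact hf1.mul_bdd (c := M) ((r n).map fun x => ψ' (x - s)).aestronglyMeasurable
            (Eventually.of_forall hM)
        rw [e1, hK, ← integral_sub i1 i2]
        simp only [mul_sub]
      simp only
      rw [e]
      refine eLpNorm_integral_mul_sq_le (k := fun t s => ψ' (t - s) - ψ' (r n t - s))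
        measurableSet_Icc hf.1.aemeasurable hsupp ?_
      exact (hψm.comp (measurable_fst.sub measurable_snd)).sub
        (hψm.comp (((r n).measurable.comp measurable_fst).sub measurable_snd))
    have := (ENNReal.continuous_rpow_const (y := 1 / 2)).tendsto 0 |>.comp hsq
    rw [ENNReal.zero_rpow_of_pos (by norm_num)] at this
    refine this.congr fun n => ?_
    rw [Function.comp_apply, ← ENNReal.rpow_natCast, ← ENNReal.rpow_mul]
    norm_num
  have hexp : ∀ n, ∫⁻ ω, ENNReal.ofReal (Real.exp (Yn n ω)) ∂P ≤
      ENNReal.ofReal (Real.exp ((1 / 2) * (eLpNorm (Kn n) 2 volume).toReal ^ 2)) := fun n =>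
    IsMeanSquareIntegral.lintegral_exp_le h'.driver (hKn2 n) (hYnm n).aestronglyMeasurable
      (IsMeanSquareIntegral.sum h'.driver.meanSquareContinuous.1 _
        (fun x _ => (h'.memLp_shift x).1.const_mul _)
        (fun x _ => ((hε.measurable x).const_mul _).aestronglyMeasurable)
        fun x _ => (h'.representation x).const_mul _)
  have ht := (ENNReal.tendsto_toReal hK2.2.ne).comp
    (tendsto_eLpNorm_of_tendsto_sub hK2 (fun n => (hKn2 n).1) hconv)
  refine ⟨aemeasurable_of_tendsto_metrizable_ae atTop (fun n => (hYnm n).aemeasurable) hYnlim,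
    (lintegral_exp_le_of_tendsto (fun n => (hYnm n).aemeasurable) hYnlim hexp
      ((ht.pow 2).const_mul (1 / 2))).trans ?_⟩
  gcongr
  have hf0 : 0 ≤ f₀ := (by positivity : (0 : ℝ) ≤ ‖g 0‖ ^ 2).trans (hb 0)
  have := ENNReal.toReal_mono (ENNReal.mul_ne_top ENNReal.ofReal_ne_top hf.2.ne) hKle
  rw [ENNReal.toReal_mul, ENNReal.toReal_ofReal (Real.sqrt_nonneg _)] at this
  calc (eLpNorm K 2 volume).toReal ^ 2
      ≤ (Real.sqrt (2 * Real.pi * f₀) * (eLpNorm f 2 volume).toReal) ^ 2 := by gcongr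
    _ = 2 * Real.pi * f₀ * ∫ t, f t ^ 2 := by
        rw [mul_pow, Real.sq_sqrt (by positivity), integral_sq_eq_toReal_eLpNorm hf]

/-- The noise integral against a continuous weight is sub-Gaussian with variance proxy
`2π f₀ ∫ φ²`. -/
theorem IsFilteredNoise.hasSubgaussianMGF (h : IsFilteredNoise P ξ ψ ε)
    (hε : IsContinuousCenteredNoise P ε) {g : ℝ → ℂ} {f₀ : ℝ} (hg : IsTransferFunction ψ g)
    (hb : ∀ x, ‖g x‖ ^ 2 ≤ f₀) {φ : ℝ → ℝ} {T : ℝ} (hT : 0 ≤ T)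
    (hφ : ContinuousOn φ (Icc 0 T)) {v : ℝ}
    (hv : 2 * Real.pi * f₀ * ∫ t in (0 : ℝ)..T, φ t ^ 2 ≤ v) :
    HasSubgaussianMGF (fun ω => ∫ t in (0 : ℝ)..T, φ t * ε t ω) v.toNNReal P := by
  set f : ℝ → ℝ := (Ioc 0 T).indicator φ with hf
  have hf0 : 0 ≤ f₀ := (by positivity : (0 : ℝ) ≤ ‖g 0‖ ^ 2).trans (hb 0)
  have hφL : MemLp φ 2 (volume.restrict (Ioc 0 T)) := by
    obtain ⟨M, hM⟩ := isCompact_Icc.exists_bound_of_continuousOn hφ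
    refine MemLp.of_bound ((hφ.mono Ioc_subset_Icc_self).aestronglyMeasurable measurableSet_Ioc)
      M ?_
    filter_upwards [ae_restrict_mem measurableSet_Ioc] with t ht
    exact hM t (Ioc_subset_Icc_self ht)
  have hfL : MemLp f 2 volume := (memLp_indicator_iff_restrict measurableSet_Ioc).2 hφL
  have hsq : ∫ t, f t ^ 2 = ∫ t in (0 : ℝ)..T, φ t ^ 2 := by
    rw [intervalIntegral.integral_of_le hT, ← integral_indicator measurableSet_Ioc]
    congr 1
    ext t
    by_cases ht : t ∈ Ioc 0 T
    · simp [hf, indicator_of_mem ht]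
    · simp [hf, indicator_of_notMem ht]
  have hW : ∀ ω, ∫ t, f t * ε t ω = ∫ t in (0 : ℝ)..T, φ t * ε t ω := by
    intro ω
    rw [intervalIntegral.integral_of_le hT, ← integral_indicator measurableSet_Ioc]
    congr 1
    ext t
    by_cases ht : t ∈ Ioc 0 T
    · simp [hf, indicator_of_mem ht]
    · simp [hf, indicator_of_notMem ht]
  have hv0 : 0 ≤ v := le_trans (mul_nonneg (by positivity)
    (intervalIntegral.integral_nonneg hT fun t _ => sq_nonneg _)) hv
  have key : ∀ u : ℝ, AEMeasurable (fun ω => u * ∫ t in (0 : ℝ)..T, φ t * ε t ω) P ∧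
      ∫⁻ ω, ENNReal.ofReal (Real.exp (u * ∫ t in (0 : ℝ)..T, φ t * ε t ω)) ∂P ≤
        ENNReal.ofReal (Real.exp (v * u ^ 2 / 2)) := by
    intro u
    have := h.lintegral_exp_integral_mul_le hε hg hb hT (hfL.const_mul u) (fun t ht => by
      rw [hf, indicator_of_notMem fun h' => ht (Ioc_subset_Icc_self h'), mul_zero])
    simp only [mul_assoc u, integral_const_mul, mul_pow, hW, hsq] at this
    refine ⟨this.1, this.2.trans (ENNReal.ofReal_le_ofReal (Real.exp_le_exp.2 ?_))⟩
    nlinarith [mul_le_mul_of_nonneg_right hv (sq_nonneg u)]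
  have hint : ∀ u : ℝ, Integrable
      (fun ω => Real.exp (u * ∫ t in (0 : ℝ)..T, φ t * ε t ω)) P := fun u =>
    (lintegral_ofReal_ne_top_iff_integrable
      (Real.measurable_exp.comp_aemeasurable (key u).1).aestronglyMeasurable
      (Eventually.of_forall fun _ => (Real.exp_pos _).le)).1
      ((key u).2.trans_lt ENNReal.ofReal_lt_top).ne
  refine ⟨hint, fun u => ?_⟩
  rw [Real.coe_toNNReal v hv0, mgf]
  have := (key u).2
  rw [← ofReal_integral_eq_lintegral_ofReal (hint u)
    (Eventually.of_forall fun _ => (Real.exp_pos _).le)] at this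
  exact (ENNReal.ofReal_le_ofReal_iff (Real.exp_pos _).le).1 this

end Noise

/-! ### Chaining -/

theorem norm_le_card_mul {q : ℕ} {x : EuclideanSpace ℝ (Fin q)} {s : ℝ}
    (h : ∀ i, |x i| ≤ s) : ‖x‖ ≤ q * s := by
  have e : x = ∑ i, x i • EuclideanSpace.single i (1 : ℝ) := by
    ext j
    simp [Finset.sum_apply, Pi.single_apply]
  calc ‖x‖ = ‖∑ i, x i • EuclideanSpace.single i (1 : ℝ)‖ := by rw [← e]
    _ ≤ ∑ i, ‖x i • EuclideanSpace.single i (1 : ℝ)‖ := norm_sum_le _ _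
    _ ≤ ∑ _i : Fin q, s := Finset.sum_le_sum fun i _ => by
        rw [norm_smul, PiLp.norm_single, norm_one, mul_one]
        exact h i
    _ = q * s := by simp

/-- Finite nets of a bounded subset of `ℝ^q`. -/
theorem exists_finset_net {q : ℕ} {S : Set (EuclideanSpace ℝ (Fin q))} {r d : ℝ}
    (hS : ∀ u ∈ S, ‖u‖ ≤ r) (hd : 0 < d) :
    ∃ N : Finset (EuclideanSpace ℝ (Fin q)), (∀ v ∈ N, v ∈ S) ∧
      (N.card : ℝ) ≤ (2 * (q + 1) * |r| / d + 2) ^ q ∧ ∀ u ∈ S, ∃ v ∈ N, ‖u - v‖ ≤ d := by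
  classical
  -- Two points of one grid cell are within q·d/(q + 1) ≤ d of each other; q + 1 instead of q avoids
  -- dividing by zero when q = 0.
  set s : ℝ := d / (q + 1) with hs
  have hs0 : 0 < s := by positivity
  set G : EuclideanSpace ℝ (Fin q) → Fin q → ℤ := fun u i => ⌊u i / s⌋ with hG
  set box : Finset (Fin q → ℤ) :=
    Fintype.piFinset fun _ => Finset.Icc ⌊-|r| / s⌋ ⌊|r| / s⌋ with hbox
  have hmem : ∀ u ∈ S, G u ∈ box := by
    intro u hu
    rw [hbox, Fintype.mem_piFinset]
    intro i
    have : |u i| ≤ |r| := (PiLp.norm_apply_le u i).trans ((hS u hu).trans (le_abs_self r))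
    rw [abs_le] at this
    rw [Finset.mem_Icc]
    exact ⟨Int.floor_le_floor (by gcongr; exact this.1), Int.floor_le_floor (by gcongr; exact this.2)⟩
  -- Only cells meeting S are kept, each represented by a point of S, since the increment bounds
  -- hold only on S.
  set B := box.filter fun z => ∃ u ∈ S, G u = z with hB
  have hch : ∀ z : Fin q → ℤ, ∃ u, z ∈ B → u ∈ S ∧ G u = z := by
    intro z
    by_cases hz : z ∈ B
    · obtain ⟨u, hu⟩ := (Finset.mem_filter.1 hz).2
      exact ⟨u, fun _ => hu⟩
    · exact ⟨0, fun h => absurd h hz⟩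
  choose rep hrep using hch
  refine ⟨B.image rep, ?_, ?_, ?_⟩
  · intro v hv
    obtain ⟨z, hz, rfl⟩ := Finset.mem_image.1 hv
    exact (hrep z hz).1
  · have h1 : ((B.image rep).card : ℝ) ≤ box.card := by
      exact_mod_cast Finset.card_image_le.trans (Finset.card_filter_le _ _)
    refine h1.trans ?_
    rw [hbox, Fintype.card_piFinset]
    simp only [Finset.prod_const, Finset.card_univ, Fintype.card_fin, Int.card_Icc]
    push_cast
    refine pow_le_pow_left₀ (by positivity) ?_ q
    have e1 : ⌊-|r| / s⌋ ≤ ⌊|r| / s⌋ := Int.floor_le_floor (by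
      gcongr
      linarith [abs_nonneg r])
    have e2 : (((⌊|r| / s⌋ + 1 - ⌊-|r| / s⌋).toNat : ℤ) : ℝ) =
        ⌊|r| / s⌋ + 1 - ⌊-|r| / s⌋ := by
      rw [Int.toNat_of_nonneg (by omega)]
      push_cast
      ring
    rw [Int.cast_natCast] at e2
    rw [e2]
    have e3 := Int.floor_le (|r| / s)
    have e4 := Int.lt_floor_add_one (-|r| / s)
    have e5 : 2 * (q + 1) * |r| / d = |r| / s - -|r| / s := by
      rw [hs]
      field_simp
      ring
    rw [e5]
    linarith
  · intro u hu
    have hz : G u ∈ B := Finset.mem_filter.2 ⟨hmem u hu, u, hu, rfl⟩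
    refine ⟨rep (G u), Finset.mem_image_of_mem _ hz, ?_⟩
    have hGe := (hrep (G u) hz).2
    refine (norm_le_card_mul (s := s) fun i => ?_).trans ?_
    · have hi : ⌊rep (G u) i / s⌋ = ⌊u i / s⌋ := congrFun hGe i
      have := Int.abs_sub_lt_one_of_floor_eq_floor hi
      rw [← sub_div, abs_div, abs_of_pos hs0, div_lt_one hs0, abs_sub_comm] at this
      exact this.le
    · rw [hs]
      rw [← mul_div_assoc, div_le_iff₀ (by positivity)]
      nlinarith

section Chaining

variable {Ω : Type*} [MeasurableSpace Ω] {P : Measure Ω}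

/-- Generic chaining bound in `ℝ^q` for a process whose increments at distance at most `d ≤ 2η`
are sub-Gaussian with variance proxy `V * d ^ (2ρ)`. -/
theorem exists_net_measure_le {q : ℕ} [IsProbabilityMeasure P]
    {S : Set (EuclideanSpace ℝ (Fin q))} {r η V ρ y : ℝ} (hS : ∀ u ∈ S, ‖u‖ ≤ r)
    (hη : 0 < η) (hV : 0 < V) (hρ : 0 < ρ) {W : EuclideanSpace ℝ (Fin q) → Ω → ℝ}
    (hinc : ∀ u ∈ S, ∀ v ∈ S, ∀ d, ‖u - v‖ ≤ d → d ≤ 2 * η →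
      HasSubgaussianMGF (fun ω => W u ω - W v ω) (V * d ^ (2 * ρ)).toNNReal P)
    (hcont : ∀ᵐ ω ∂P, ContinuousOn (fun u => W u ω) S)
    (hy : 2 * V * (2 * η) ^ (2 * ρ) * y ≤ (1 - (2 : ℝ) ^ (-(ρ / 2))) ^ 2)
    (hyρ : 4 * q + 2 ≤ y * ρ) :
    ∃ N : Finset (EuclideanSpace ℝ (Fin q)), (∀ v ∈ N, v ∈ S) ∧
      (N.card : ℝ) ≤ (2 * (q + 1) * |r| / η + 2) ^ q ∧
      P.real {ω | ¬ ∀ u ∈ S, ∃ v ∈ N, ‖u - v‖ ≤ η ∧ W u ω ≤ W v ω + 1} ≤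
        2 ^ (q + 1) * ((2 * (q + 1) * |r| / η + 2) ^ q) ^ 2 * Real.exp (-y) := by
  set s : ℝ := (2 : ℝ) ^ (-(ρ / 2)) with hs
  have hs0 : 0 < s := by positivity
  have hs1 : s < 1 := Real.rpow_lt_one_of_one_lt_of_neg (by norm_num) (by linarith)
  set M₀ : ℝ := 2 * (q + 1) * |r| / η + 2 with hM₀
  have hM₀1 : 2 ≤ M₀ := by
    rw [hM₀]
    have : 0 ≤ 2 * ((q : ℝ) + 1) * |r| / η := by positivity
    linarith
  set d : ℕ → ℝ := fun k => η / 2 ^ k with hd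
  have hd0 : ∀ k, 0 < d k := fun k => by positivity
  have hdη : ∀ k, d k ≤ η := fun k => div_le_self hη.le (one_le_pow₀ (by norm_num))
  have hds : ∀ k, d (k + 1) ≤ d k := fun k => by
    simp only [hd, pow_succ]
    gcongr
    linarith [pow_pos (two_pos : (0 : ℝ) < 2) k]
  choose N hNS hNc hNn using fun k => exists_finset_net (q := q) hS (hd0 k)
  have hcard : ∀ k, ((N k).card : ℝ) ≤ M₀ ^ q * (2 ^ k) ^ q := by
    intro k
    refine (hNc k).trans ?_
    rw [← mul_pow]
    refine pow_le_pow_left₀ (by positivity) ?_ q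
    have h1 : (1 : ℝ) ≤ 2 ^ k := one_le_pow₀ (by norm_num)
    have h2 : 2 * ((q : ℝ) + 1) * |r| / d k = 2 * (q + 1) * |r| / η * 2 ^ k := by
      simp only [hd]
      field_simp
    rw [h2, hM₀]
    nlinarith
  -- The thresholds sum to 1, the rise allowed above the net. The variance proxies shrink like
  -- s^(4k), so the Gaussian exponents grow like s^(−2k).
  set x : ℕ → ℝ := fun k => (1 - s) * s ^ k with hx
  -- Bad event of level k: some link from net k to net k + 1 rises by at least its threshold. Only
  -- upward increments matter.
  set A : ℕ → Set Ω := fun k => ⋃ p ∈ ((N k) ×ˢ (N (k + 1))).filter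
    (fun p => ‖p.2 - p.1‖ ≤ 2 * d k), {ω | x k ≤ W p.2 ω - W p.1 ω} with hA
  have hAk : ∀ k, P.real (A k) ≤
      2 ^ q * (M₀ ^ q) ^ 2 * Real.exp (-y) * Real.exp (-1) ^ k := by
    intro k
    have hdk : (2 * d k) ^ (2 * ρ) = (2 * η) ^ (2 * ρ) * s ^ (4 * k) := by
      have e : 2 * d k = 2 * η * (2 : ℝ) ^ (-(k : ℝ)) := by
        rw [Real.rpow_neg (by norm_num), Real.rpow_natCast]
        simp only [hd]
        ring
      rw [e, Real.mul_rpow (by positivity) (by positivity), hs, ← Real.rpow_mul (by norm_num),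
        ← Real.rpow_natCast, ← Real.rpow_mul (by norm_num)]
      congr 2
      push_cast
      ring
    -- Since s^(−2k) = 2^(ρk) ≥ 1 + ρk log 2, the exponents grow at least linearly in k, enough
    -- against the geometrically growing number of links.
    have hsk : 1 + ρ * k / 2 ≤ (s ^ (2 * k))⁻¹ := by
      have e : (s ^ (2 * k))⁻¹ = Real.exp (Real.log 2 * (ρ * k)) := by
        rw [hs, ← Real.rpow_natCast, ← Real.rpow_mul (by norm_num), ← Real.rpow_neg (by norm_num),
          Real.rpow_def_of_pos (by norm_num)]
        congr 2
        push_cast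
        ring
      rw [e]
      have h1 := Real.add_one_le_exp (Real.log 2 * (ρ * k))
      have h2 := Real.log_two_gt_d9
      have h3 : 0 ≤ ρ * k := by positivity
      nlinarith
    have hpair : ∀ p ∈ ((N k) ×ˢ (N (k + 1))).filter (fun p => ‖p.2 - p.1‖ ≤ 2 * d k),
        P.real {ω | x k ≤ W p.2 ω - W p.1 ω} ≤
          Real.exp (-y) * Real.exp (-(y * ρ / 2)) ^ k := by
      intro p hp
      rw [Finset.mem_filter, Finset.mem_product] at hp
      have := (hinc p.2 (hNS _ _ hp.1.2) p.1 (hNS _ _ hp.1.1) (2 * d k) hp.2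
        (by linarith [hdη k])).measure_ge_le (ε := x k) (by
          simp only [hx]; exact mul_nonneg (by linarith) (by positivity))
      refine this.trans ?_
      rw [← Real.exp_nat_mul, ← Real.exp_add, Real.exp_le_exp,
        Real.coe_toNNReal _ (by positivity), hdk, neg_div]
      have hy0 : 0 ≤ y := by
        have h1 : 0 ≤ y * ρ := by
          have : (0 : ℝ) ≤ q := q.cast_nonneg
          linarith
        exact nonneg_of_mul_nonneg_left h1 hρ
      have h1 : y * (s ^ (2 * k))⁻¹ ≤
          x k ^ 2 / (2 * (V * ((2 * η) ^ (2 * ρ) * s ^ (4 * k)))) := by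
        rw [le_div_iff₀ (by positivity)]
        simp only [hx]
        have e : y * (s ^ (2 * k))⁻¹ * (2 * (V * ((2 * η) ^ (2 * ρ) * s ^ (4 * k)))) =
            (2 * V * (2 * η) ^ (2 * ρ) * y) * s ^ (2 * k) := by
          have : s ^ (4 * k) = s ^ (2 * k) * s ^ (2 * k) := by rw [← pow_add]; congr 1; ring
          rw [this]
          field_simp
        rw [e, mul_pow, ← pow_mul, mul_comm k 2]
        gcongr
      have h2 := mul_le_mul_of_nonneg_left hsk hy0
      calc -(x k ^ 2 / (2 * (V * ((2 * η) ^ (2 * ρ) * s ^ (4 * k)))))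
          ≤ -(y * (1 + ρ * k / 2)) := by linarith
        _ = -y + k * -(y * ρ / 2) := by ring
    have hc : ((((N k) ×ˢ (N (k + 1))).filter (fun p => ‖p.2 - p.1‖ ≤ 2 * d k)).card : ℝ) ≤
        2 ^ q * (M₀ ^ q) ^ 2 * Real.exp (2 * q) ^ k := by
      have h1 : ((((N k) ×ˢ (N (k + 1))).filter (fun p => ‖p.2 - p.1‖ ≤ 2 * d k)).card : ℝ) ≤
          (N k).card * (N (k + 1)).card := by
        exact_mod_cast (Finset.card_filter_le _ _).trans (Finset.card_product _ _).le
      refine h1.trans ((mul_le_mul (hcard k) (hcard (k + 1)) (by positivity)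
        (by positivity)).trans ?_)
      have h4 : (4 : ℝ) ≤ Real.exp 2 := by
        have h := Real.exp_one_gt_d9
        have e : Real.exp 2 = Real.exp 1 * Real.exp 1 := by rw [← Real.exp_add]; norm_num
        rw [e]
        nlinarith
      have e1 : M₀ ^ q * (2 ^ k) ^ q * (M₀ ^ q * (2 ^ (k + 1)) ^ q) =
          2 ^ q * (M₀ ^ q) ^ 2 * (4 ^ q) ^ k := by
        have e4 : ((4 : ℝ) ^ q) ^ k = (2 ^ k) ^ q * (2 ^ k) ^ q := by
          rw [← mul_pow, ← mul_pow, ← pow_mul, ← pow_mul, mul_comm q k]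
          norm_num
        rw [e4, pow_succ, mul_pow]
        ring
      have e2 : Real.exp (2 * q) = Real.exp 2 ^ q := by
        rw [← Real.exp_nat_mul, mul_comm]
      rw [e1, e2]
      gcongr
    calc P.real (A k)
        ≤ ∑ p ∈ ((N k) ×ˢ (N (k + 1))).filter (fun p => ‖p.2 - p.1‖ ≤ 2 * d k),
          P.real {ω | x k ≤ W p.2 ω - W p.1 ω} := measureReal_biUnion_finset_le _ _
      _ ≤ ∑ _p ∈ ((N k) ×ˢ (N (k + 1))).filter (fun p => ‖p.2 - p.1‖ ≤ 2 * d k),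
          Real.exp (-y) * Real.exp (-(y * ρ / 2)) ^ k := Finset.sum_le_sum hpair
      _ = _ * (Real.exp (-y) * Real.exp (-(y * ρ / 2)) ^ k) := by
          rw [Finset.sum_const, nsmul_eq_mul]
      _ ≤ 2 ^ q * (M₀ ^ q) ^ 2 * Real.exp (2 * q) ^ k *
          (Real.exp (-y) * Real.exp (-(y * ρ / 2)) ^ k) := by gcongr
      _ = 2 ^ q * (M₀ ^ q) ^ 2 * Real.exp (-y) *
          (Real.exp (2 * q) * Real.exp (-(y * ρ / 2))) ^ k := by rw [mul_pow]; ring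
      -- The condition yρ ≥ 4q + 2 makes the geometric ratio at most e^(−1).
      _ ≤ 2 ^ q * (M₀ ^ q) ^ 2 * Real.exp (-y) * Real.exp (-1) ^ k := by
          rw [← Real.exp_add]
          gcongr
          linarith
  have he : Real.exp (-1) ≤ 1 / 2 := by
    rw [Real.exp_neg, one_div]
    exact inv_anti₀ (by norm_num) (by linarith [Real.exp_one_gt_d9])
  have hsum : HasSum (fun k => 2 ^ q * (M₀ ^ q) ^ 2 * Real.exp (-y) * Real.exp (-1) ^ k)
      (2 ^ q * (M₀ ^ q) ^ 2 * Real.exp (-y) * (1 - Real.exp (-1))⁻¹) :=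
    (hasSum_geometric_of_lt_one (Real.exp_pos _).le (by linarith)).mul_left _
  have hunion : P.real (⋃ k, A k) ≤ 2 ^ (q + 1) * (M₀ ^ q) ^ 2 * Real.exp (-y) := by
    have h1 : P (⋃ k, A k) ≤ ENNReal.ofReal
        (2 ^ q * (M₀ ^ q) ^ 2 * Real.exp (-y) * (1 - Real.exp (-1))⁻¹) := by
      rw [← hsum.tsum_eq, ENNReal.ofReal_tsum_of_nonneg (fun k => by positivity) hsum.summable]
      refine (measure_iUnion_le _).trans (ENNReal.tsum_le_tsum fun k => ?_)
      rw [← ofReal_measureReal (measure_ne_top P _)]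
      exact ENNReal.ofReal_le_ofReal (hAk k)
    have h2 : (1 - Real.exp (-1))⁻¹ ≤ 2 := by
      rw [inv_le_comm₀ (by linarith) (by norm_num)]
      linarith
    have h3 := ENNReal.toReal_le_of_le_ofReal (mul_nonneg (by positivity)
      (inv_nonneg.2 (by linarith))) h1
    refine h3.trans ((mul_le_mul_of_nonneg_left h2 (by positivity)).trans (le_of_eq ?_))
    ring
  refine ⟨N 0, hNS 0, by simpa using hcard 0, ?_⟩
  have hsub : {ω | ¬ ∀ u ∈ S, ∃ v ∈ N 0, ‖u - v‖ ≤ η ∧ W u ω ≤ W v ω + 1} ⊆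
      (⋃ k, A k) ∪ {ω | ¬ ContinuousOn (fun u => W u ω) S} := by
    intro ω hω
    by_contra hcon
    simp only [mem_union, mem_iUnion, mem_ofPred_eq, not_or, not_exists, not_not] at hcon
    obtain ⟨hnA, hc⟩ := hcon
    refine hω fun u hu => ?_
    choose v hvN hvd using fun k => hNn k u hu
    have hvS : ∀ k, v k ∈ S := fun k => hNS k _ (hvN k)
    have hstep : ∀ k, W (v (k + 1)) ω - W (v k) ω ≤ x k := by
      intro k
      by_contra hlt
      refine hnA k ?_
      simp only [hA, mem_iUnion]
      refine ⟨(v k, v (k + 1)), Finset.mem_filter.2 ⟨Finset.mem_product.2 ⟨hvN k, hvN (k + 1)⟩, ?_⟩,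
        (not_le.1 hlt).le⟩
      calc ‖v (k + 1) - v k‖ = ‖(u - v k) - (u - v (k + 1))‖ := by congr 1; abel
        _ ≤ ‖u - v k‖ + ‖u - v (k + 1)‖ := norm_sub_le _ _
        _ ≤ 2 * d k := by linarith [hvd k, hvd (k + 1), hds k]
    have hsumle : ∀ n, W (v n) ω ≤ W (v 0) ω + (1 - s ^ n) := by
      intro n
      induction n with
      | zero => simp
      | succ n ih =>
        have := hstep n
        simp only [hx] at this
        rw [pow_succ]
        linarith
    have hvlim : Tendsto v atTop (𝓝 u) := by
      rw [tendsto_iff_norm_sub_tendsto_zero]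
      have hd_lim : Tendsto d atTop (𝓝 0) := by
        have := (tendsto_pow_atTop_nhds_zero_of_lt_one (by norm_num : (0 : ℝ) ≤ 1 / 2)
          (by norm_num)).const_mul η
        rw [mul_zero] at this
        refine this.congr fun n => ?_
        simp only [hd, one_div, inv_pow]
        rfl
      refine squeeze_zero (fun _ => norm_nonneg _) (fun n => ?_) hd_lim
      rw [norm_sub_rev]
      exact hvd n
    have hWlim : Tendsto (fun n => W (v n) ω) atTop (𝓝 (W u ω)) :=
      (hc u hu).tendsto.comp (tendsto_nhdsWithin_iff.2 ⟨hvlim, Eventually.of_forall hvS⟩)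
    refine ⟨v 0, hvN 0, by simpa [hd] using hvd 0, le_of_tendsto hWlim
      (Eventually.of_forall fun n => (hsumle n).trans ?_)⟩
    linarith [pow_pos hs0 n]
  have hnull : P.real {ω | ¬ ContinuousOn (fun u => W u ω) S} = 0 := by
    rw [measureReal_def, ae_iff.1 hcont, ENNReal.toReal_zero]
  calc _ ≤ P.real ((⋃ k, A k) ∪ {ω | ¬ ContinuousOn (fun u => W u ω) S}) := measureReal_mono hsub
    _ ≤ P.real (⋃ k, A k) + P.real {ω | ¬ ContinuousOn (fun u => W u ω) S} :=
        measureReal_union_le _ _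
    _ ≤ _ := by rw [hnull, add_zero]; exact hunion

end Chaining

/-! ### Geometry of the local parameter domain and the least squares inequality -/

section Regression

variable {q : ℕ} {Θ : Set (EuclideanSpace ℝ (Fin q))} {a : ℝ → EuclideanSpace ℝ (Fin q) → ℝ}
  {θ : EuclideanSpace ℝ (Fin q)} {T : ℝ}

theorem normingInv_norming (hd : ∀ i, 0 < normEntry a θ T i) (x : EuclideanSpace ℝ (Fin q)) :
    normingInv a θ T (norming a θ T x) = x := by
  ext i
  simp [normingInv, norming, (hd i).ne']

theorem normingInv_zero : normingInv a θ T 0 = 0 := by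
  ext i
  simp [normingInv]

theorem norming_smul (c : ℝ) (x : EuclideanSpace ℝ (Fin q)) :
    norming a θ T (c • x) = c • norming a θ T x := by
  ext i
  simp [norming]
  ring

theorem continuous_normingInv : Continuous (normingInv a θ T) := by
  unfold normingInv
  fun_prop

theorem localIncrement_zero (t : ℝ) : localIncrement a θ T t 0 = 0 := by
  simp [localIncrement, normingInv_zero]

theorem add_normingInv_mem (hd : ∀ i, 0 < normEntry a θ T i) {u : EuclideanSpace ℝ (Fin q)}
    (hu : u ∈ localDomain Θ a θ T) : θ + normingInv a θ T u ∈ closure Θ := by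
  obtain ⟨τ, hτ, rfl⟩ := hu
  simpa [normingInv_norming hd] using hτ

theorem localIncrement_norming (hd : ∀ i, 0 < normEntry a θ T i) (t : ℝ)
    (τ : EuclideanSpace ℝ (Fin q)) :
    localIncrement a θ T t (norming a θ T (τ - θ)) = a t τ - a t θ := by
  simp [localIncrement, normingInv_norming hd]

theorem smul_mem_localDomain (hconv : Convex ℝ Θ) (hθ : θ ∈ Θ) {u : EuclideanSpace ℝ (Fin q)}
    (hu : u ∈ localDomain Θ a θ T) {c : ℝ} (h0 : 0 ≤ c) (h1 : c ≤ 1) :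
    c • u ∈ localDomain Θ a θ T := by
  obtain ⟨τ, hτ, rfl⟩ := hu
  refine ⟨θ + c • (τ - θ), hconv.closure.add_smul_sub_mem (subset_closure hθ) hτ ⟨h0, h1⟩, ?_⟩
  simp [← norming_smul]

/-- The local domain is star-shaped about 0, so a point beyond radius R can be pulled back to norm
exactly R. -/
theorem shell_nonempty (hconv : Convex ℝ Θ) (hθ : θ ∈ Θ) {u : EuclideanSpace ℝ (Fin q)}
    (hu : u ∈ localDomain Θ a θ T) {R : ℝ} (hR : 0 < R) (hRu : R ≤ ‖u‖) :
    (shell Θ a θ T R).Nonempty := by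
  have hu0 : 0 < ‖u‖ := hR.trans_le hRu
  refine ⟨(R / ‖u‖) • u, smul_mem_localDomain hconv hθ hu (by positivity)
    ((div_le_one hu0).2 hRu), ?_⟩
  have : ‖(R / ‖u‖) • u‖ = R := by
    rw [norm_smul, Real.norm_of_nonneg (by positivity), div_mul_cancel₀ _ hu0.ne']
  simp [this]

theorem normEntry_mono {T' : ℝ} (hT : 0 ≤ T) (hTT' : T ≤ T') {i : Fin q}
    (h : 0 < normEntry a θ T' i) : normEntry a θ T i ≤ normEntry a θ T' i := by
  have hint : IntervalIntegrable
      (fun t => (fderiv ℝ (a t) θ (EuclideanSpace.single i 1)) ^ 2) volume 0 T' := by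
    -- Without integrability the integral is 0 by convention, contradicting positivity.
    by_contra hcon
    rw [normEntry, intervalIntegral.integral_undef hcon, Real.sqrt_zero] at h
    exact lt_irrefl _ h
  refine Real.sqrt_le_sqrt ?_
  exact intervalIntegral.integral_mono_interval le_rfl hT hTT'
    (Eventually.of_forall fun _ => sq_nonneg _) hint

/-- Θ is bounded and the norming entries increase with T, so those at T₁ control all smaller T. This
disposes of the times at which the rate condition is unavailable. -/
theorem exists_localDomain_bound (hbdd : Bornology.IsBounded Θ) {T₀ T₁ : ℝ} (hT₀ : 0 ≤ T₀)
    (hT₁ : T₀ < T₁) (hd : ∀ T > T₀, ∀ i, 0 < normEntry a θ T i) :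
    ∃ C : ℝ, ∀ T, T₀ < T → T ≤ T₁ → ∀ u ∈ localDomain Θ a θ T, ‖u‖ ≤ C := by
  obtain ⟨r, hr⟩ := hbdd.closure.subset_closedBall θ
  set D : ℝ := ∑ i, normEntry a θ T₁ i with hD
  have hDi : ∀ i, normEntry a θ T₁ i ≤ D := fun i =>
    Finset.single_le_sum (fun j _ => (hd T₁ hT₁ j).le) (Finset.mem_univ i)
  refine ⟨q * (D * r), ?_⟩
  rintro T hT hTT₁ _ ⟨τ, hτ, rfl⟩
  refine norm_le_card_mul fun i => ?_
  have h1 : |(τ - θ) i| ≤ r := (PiLp.norm_apply_le (τ - θ) i).trans (by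
    simpa [dist_eq_norm] using hr hτ)
  have h2 := (normEntry_mono (hT₀.trans hT.le) hTT₁ (hd T₁ hT₁ i)).trans (hDi i)
  simp only [norming, abs_mul, abs_of_pos (hd T hT i)]
  have h3 := hd T hT i
  gcongr
  exact h3.le.trans h2

theorem IsRegressionFunction.continuousOn_localIncrement (ha : IsRegressionFunction Θ a)
    (hθ : θ ∈ Θ) (hd : ∀ i, 0 < normEntry a θ T i) {u : EuclideanSpace ℝ (Fin q)}
    (hu : u ∈ localDomain Θ a θ T) :
    ContinuousOn (fun t => localIncrement a θ T t u) (Icc 0 T) := by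
  have h : ∀ τ ∈ closure Θ, ContinuousOn (fun t => a t τ) (Icc 0 T) := fun τ hτ =>
    ha.continuousOn.comp (f := fun t => (t, τ)) (by fun_prop) fun t ht => ⟨ht.1, hτ⟩
  exact (h _ (add_normingInv_mem hd hu)).sub (h θ (subset_closure hθ))

theorem zero_mem_localDomain (hθ : θ ∈ Θ) : (0 : EuclideanSpace ℝ (Fin q)) ∈ localDomain Θ a θ T :=
  ⟨θ, subset_closure hθ, by ext i; simp [norming]⟩

theorem discrepancy_zero_right (u : EuclideanSpace ℝ (Fin q)) :
    discrepancy a θ T u 0 = ∫ t in (0 : ℝ)..T, localIncrement a θ T t u ^ 2 := by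
  simp [discrepancy, localIncrement_zero]

/-- `Φ(u, 0) ≥ (9/10) Φ(v, 0) - 10 Φ(u, v)`. -/
theorem IsRegressionFunction.discrepancy_triangle (ha : IsRegressionFunction Θ a) (hθ : θ ∈ Θ)
    (hT : 0 ≤ T) (hd : ∀ i, 0 < normEntry a θ T i) {u v : EuclideanSpace ℝ (Fin q)}
    (hu : u ∈ localDomain Θ a θ T) (hv : v ∈ localDomain Θ a θ T) :
    9 / 10 * discrepancy a θ T v 0 - 10 * discrepancy a θ T u v ≤ discrepancy a θ T u 0 := by
  have cu := ha.continuousOn_localIncrement hθ hd hu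
  have cv := ha.continuousOn_localIncrement hθ hd hv
  have ii : ∀ {f : ℝ → ℝ}, ContinuousOn f (Icc 0 T) → IntervalIntegrable f volume 0 T :=
    fun hf => ContinuousOn.intervalIntegrable (by rwa [uIcc_of_le hT])
  have i1 : IntervalIntegrable (fun t => localIncrement a θ T t u ^ 2) volume 0 T :=
    ii (cu.pow 2)
  have i2 : IntervalIntegrable (fun t => localIncrement a θ T t v ^ 2) volume 0 T :=
    ii (cv.pow 2)
  have i3 : IntervalIntegrable
      (fun t => (localIncrement a θ T t u - localIncrement a θ T t v) ^ 2) volume 0 T :=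
    ii ((cu.sub cv).pow 2)
  rw [discrepancy_zero_right, discrepancy_zero_right, discrepancy,
    ← intervalIntegral.integral_const_mul, ← intervalIntegral.integral_const_mul,
    ← intervalIntegral.integral_sub (i2.const_mul _) (i3.const_mul _)]
  refine intervalIntegral.integral_mono_on hT ((i2.const_mul _).sub (i3.const_mul _)) i1
    fun t _ => ?_
  set x := localIncrement a θ T t u
  set y := localIncrement a θ T t v
  nlinarith [sq_nonneg (y + 10 * (x - y))]

/-! ### The noise functional W and its increments. -/

section Noise

variable {Ω : Type*} {ε : ℝ → Ω → ℝ}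

/-- The noise functional `W(u) = ∫_0^T Δ(t, u) ε(t) dt`. -/
noncomputable def noiseFunctional (a : ℝ → EuclideanSpace ℝ (Fin q) → ℝ)
    (θ : EuclideanSpace ℝ (Fin q)) (T : ℝ) (ε : ℝ → Ω → ℝ) (u : EuclideanSpace ℝ (Fin q)) (ω : Ω) : ℝ :=
  ∫ t in (0 : ℝ)..T, localIncrement a θ T t u * ε t ω

/-- A minimizer of the least squares functional satisfies `Φ(u, 0) ≤ 2 W(u)`. -/
theorem IsRegressionFunction.discrepancy_le_of_isMinOn (ha : IsRegressionFunction Θ a)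
    (hθ : θ ∈ Θ) (hT : 0 ≤ T) (hd : ∀ i, 0 < normEntry a θ T i) {ω : Ω}
    (hω : Continuous fun t => ε t ω) {τ : EuclideanSpace ℝ (Fin q)} (hτ : τ ∈ closure Θ)
    (hmin : IsMinOn (fun τ => leastSquares a (observation a θ ε) T τ ω) (closure Θ) τ) :
    discrepancy a θ T (norming a θ T (τ - θ)) 0 ≤
      2 * noiseFunctional a θ T ε (norming a θ T (τ - θ)) ω := by
  set u := norming a θ T (τ - θ) with hu
  have hum : u ∈ localDomain Θ a θ T := ⟨τ, hτ, rfl⟩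
  have cu := ha.continuousOn_localIncrement hθ hd hum
  have ii : ∀ {f : ℝ → ℝ}, ContinuousOn f (Icc 0 T) → IntervalIntegrable f volume 0 T :=
    fun hf => ContinuousOn.intervalIntegrable (by rwa [uIcc_of_le hT])
  have i1 : IntervalIntegrable (fun t => localIncrement a θ T t u ^ 2) volume 0 T :=
    ii (cu.pow 2)
  have i2 : IntervalIntegrable (fun t => localIncrement a θ T t u * ε t ω) volume 0 T :=
    ii (cu.mul hω.continuousOn)
  have i3 : IntervalIntegrable (fun t => ε t ω ^ 2) volume 0 T := ii (hω.continuousOn.pow 2)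
  -- The comparison point is θ, where the residual is exactly the noise.
  have h := hmin (subset_closure hθ)
  simp only [mem_ofPred_eq, leastSquares, observation, add_sub_cancel_left] at h
  have e : ∀ t, (a t θ + ε t ω - a t τ) ^ 2 =
      ε t ω ^ 2 - 2 * (localIncrement a θ T t u * ε t ω) + localIncrement a θ T t u ^ 2 := by
    intro t
    rw [hu, localIncrement_norming hd]
    ring
  simp_rw [e] at h
  rw [intervalIntegral.integral_add (i3.sub (i2.const_mul 2)) i1,
    intervalIntegral.integral_sub i3 (i2.const_mul 2), intervalIntegral.integral_const_mul] at h
  rw [discrepancy_zero_right, noiseFunctional]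
  linarith

/-- Dominated convergence, the integrand being bounded on the compact set [0, T] × closure Θ.
Chaining uses this to pass from nets to the whole shell. -/
theorem IsRegressionFunction.continuousOn_noiseFunctional (ha : IsRegressionFunction Θ a)
    (hbdd : Bornology.IsBounded Θ) (hθ : θ ∈ Θ) (hT : 0 ≤ T) (hd : ∀ i, 0 < normEntry a θ T i)
    {ω : Ω} (hω : Continuous fun t => ε t ω) :
    ContinuousOn (fun u => noiseFunctional a θ T ε u ω) (localDomain Θ a θ T) := by
  have hc : ContinuousOn
      (fun p : ℝ × EuclideanSpace ℝ (Fin q) => (a p.1 p.2 - a p.1 θ) * ε p.1 ω)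
      (Icc 0 T ×ˢ closure Θ) := by
    have h1 : ContinuousOn (fun p : ℝ × EuclideanSpace ℝ (Fin q) => a p.1 p.2)
        (Icc 0 T ×ˢ closure Θ) :=
      ha.continuousOn.mono (prod_mono Icc_subset_Ici_self subset_rfl)
    have h2 : ContinuousOn (fun p : ℝ × EuclideanSpace ℝ (Fin q) => a p.1 θ)
        (Icc 0 T ×ˢ closure Θ) :=
      ha.continuousOn.comp (f := fun p : ℝ × EuclideanSpace ℝ (Fin q) => (p.1, θ)) (by fun_prop)
        fun p hp => ⟨hp.1.1, subset_closure hθ⟩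
    exact (h1.sub h2).mul (hω.comp continuous_fst).continuousOn
  obtain ⟨M, hM⟩ := (isCompact_Icc.prod hbdd.isCompact_closure).exists_bound_of_continuousOn hc
  have hF : ContinuousOn (fun τ => ∫ t in (0 : ℝ)..T, (a t τ - a t θ) * ε t ω) (closure Θ) := by
    intro τ hτ
    refine intervalIntegral.continuousWithinAt_of_dominated_interval (bound := fun _ => M) ?_ ?_
      (intervalIntegrable_const) ?_
    · filter_upwards [self_mem_nhdsWithin] with τ' hτ'
      have : ContinuousOn (fun t => (a t τ' - a t θ) * ε t ω) (Icc 0 T) :=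
        hc.comp (f := fun t => (t, τ')) (by fun_prop) fun t ht => ⟨ht, hτ'⟩
      rw [uIoc_of_le hT]
      exact (this.mono Ioc_subset_Icc_self).aestronglyMeasurable measurableSet_Ioc
    · filter_upwards [self_mem_nhdsWithin] with τ' hτ'
      refine Eventually.of_forall fun t ht => ?_
      rw [uIoc_of_le hT] at ht
      exact hM (t, τ') ⟨Ioc_subset_Icc_self ht, hτ'⟩
    · refine Eventually.of_forall fun t ht => ?_
      rw [uIoc_of_le hT] at ht
      exact (hc.comp (f := fun τ' => (t, τ')) (by fun_prop)
        fun τ' hτ' => ⟨Ioc_subset_Icc_self ht, hτ'⟩) τ hτ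
  exact hF.comp (f := fun u => θ + normingInv a θ T u)
    (continuous_const.add continuous_normingInv).continuousOn
    fun u hu => add_normingInv_mem hd hu

variable [MeasurableSpace Ω] {P : Measure Ω} {ξ : ℝ → Ω → ℝ} {ψ : ℝ → ℝ} {h : ℝ → ℂ} {f₀ : ℝ}

/-- Increments of the noise functional are sub-Gaussian with variance proxy `2π f₀ Φ(u, v)`. -/
theorem IsFilteredNoise.hasSubgaussianMGF_noiseFunctional_sub (hfilter : IsFilteredNoise P ξ ψ ε)
    (hε : IsContinuousCenteredNoise P ε) (hh : IsTransferFunction ψ h)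
    (hb : ∀ x, ‖h x‖ ^ 2 ≤ f₀) (ha : IsRegressionFunction Θ a) (hθ : θ ∈ Θ)
    (hT : 0 ≤ T) (hd : ∀ i, 0 < normEntry a θ T i) {u v : EuclideanSpace ℝ (Fin q)}
    (hu : u ∈ localDomain Θ a θ T) (hv : v ∈ localDomain Θ a θ T) {V : ℝ}
    (hV : 2 * Real.pi * f₀ * discrepancy a θ T u v ≤ V) :
    HasSubgaussianMGF
      (fun ω => noiseFunctional a θ T ε u ω - noiseFunctional a θ T ε v ω) V.toNNReal P := by
  have cu := ha.continuousOn_localIncrement hθ hd hu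
  have cv := ha.continuousOn_localIncrement hθ hd hv
  refine (hfilter.hasSubgaussianMGF hε hh hb hT (cu.sub cv) hV).congr ?_
  filter_upwards [hε.continuousPaths] with ω hω
  have ii : ∀ {f : ℝ → ℝ}, ContinuousOn f (Icc 0 T) → IntervalIntegrable f volume 0 T :=
    fun hf => ContinuousOn.intervalIntegrable (by rwa [uIcc_of_le hT])
  have i1 : IntervalIntegrable (fun t => localIncrement a θ T t u * ε t ω) volume 0 T :=
    ii (cu.mul hω.continuousOn)
  have i2 : IntervalIntegrable (fun t => localIncrement a θ T t v * ε t ω) volume 0 T :=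
    ii (cv.mul hω.continuousOn)
  rw [noiseFunctional, noiseFunctional, ← intervalIntegral.integral_sub i1 i2]
  simp only [Pi.sub_apply, sub_mul]

theorem IsFilteredNoise.hasSubgaussianMGF_noiseFunctional (hfilter : IsFilteredNoise P ξ ψ ε)
    (hε : IsContinuousCenteredNoise P ε) (hh : IsTransferFunction ψ h)
    (hb : ∀ x, ‖h x‖ ^ 2 ≤ f₀) (ha : IsRegressionFunction Θ a) (hθ : θ ∈ Θ)
    (hT : 0 ≤ T) (hd : ∀ i, 0 < normEntry a θ T i) {u : EuclideanSpace ℝ (Fin q)}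
    (hu : u ∈ localDomain Θ a θ T) :
    HasSubgaussianMGF (fun ω => noiseFunctional a θ T ε u ω)
      (2 * Real.pi * f₀ * discrepancy a θ T u 0).toNNReal P := by
  have := hfilter.hasSubgaussianMGF_noiseFunctional_sub hε hh hb ha hθ hT hd hu
    (zero_mem_localDomain hθ) le_rfl
  simpa [noiseFunctional, localIncrement_zero] using this

end Noise

end Regression

/-! ### Deviation bounds over shells -/

theorem exists_eval_le_const_mul_pow (p : Polynomial ℝ) :
    ∃ C : ℝ, 0 ≤ C ∧ ∀ R : ℝ, 1 ≤ R → p.eval R ≤ C * R ^ p.natDegree := by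
  refine ⟨∑ i ∈ Finset.range (p.natDegree + 1), |p.coeff i|,
    Finset.sum_nonneg fun _ _ => abs_nonneg _, fun R hR => ?_⟩
  rw [Polynomial.eval_eq_sum_range, Finset.sum_mul]
  refine Finset.sum_le_sum fun i hi => ?_
  refine mul_le_mul (le_abs_self _) (pow_le_pow_right₀ hR ?_) (by positivity) (abs_nonneg _)
  exact Nat.lt_succ_iff.1 (Finset.mem_range.1 hi)

theorem exists_common_polynomial_bound (p p' : Polynomial ℝ) :
    ∃ (C : ℝ) (m : ℕ), 0 < C ∧ ∀ R : ℝ, 1 ≤ R → p.eval R ≤ C * R ^ m ∧ p'.eval R ≤ C * R ^ m := by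
  obtain ⟨C, hC, h⟩ := exists_eval_le_const_mul_pow p
  obtain ⟨C', hC', h'⟩ := exists_eval_le_const_mul_pow p'
  refine ⟨C + C' + 1, p.natDegree + p'.natDegree, by positivity, fun R hR => ⟨?_, ?_⟩⟩
  · refine (h R hR).trans (mul_le_mul (by linarith) (pow_le_pow_right₀ hR (by omega))
      (by positivity) (by positivity))
  · refine (h' R hR).trans (mul_le_mul (by linarith) (pow_le_pow_right₀ hR (by omega))
      (by positivity) (by positivity))

/-- Base mesh for the shells: the bound with A keeps Φ_T at most 1 across the mesh, and the one with
B is the smallness condition of the chaining. -/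
theorem exists_small_scale {κ ρ c : ℝ} (A B : ℝ) (hκ : 0 < κ) (hρ : 0 < ρ) (hc : 0 < c) :
    ∃ η : ℝ, 0 < η ∧ 2 * η ≤ κ ∧ A * η ^ (2 * ρ) ≤ 1 ∧ B * η ^ (2 * ρ) ≤ c := by
  have h0 : Tendsto (fun η : ℝ => η ^ (2 * ρ)) (𝓝[>] 0) (𝓝 0) := by
    have := (Real.continuousAt_rpow_const 0 (2 * ρ) (Or.inr (by positivity))).tendsto
    rw [Real.zero_rpow (by positivity)] at this
    exact this.mono_left nhdsWithin_le_nhds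
  have hA := h0.const_mul A
  have hB := h0.const_mul B
  rw [mul_zero] at hA hB
  have h2 : ∀ᶠ η : ℝ in 𝓝[>] 0, 2 * η ≤ κ := by
    filter_upwards [Ioo_mem_nhdsGT (by positivity : (0 : ℝ) < κ / 2)] with η hη
    linarith [hη.2]
  obtain ⟨η, h⟩ := (((eventually_mem_nhdsWithin (s := Ioi (0 : ℝ)) (a := 0)).and h2).and
    ((hA.eventually_le_const one_pos).and (hB.eventually_le_const hc))).exists
  exact ⟨η, h.1.1, h.1.2, h.2.1, h.2.2⟩

section Deviation

variable {Ω : Type*} [MeasurableSpace Ω] {P : Measure Ω} {q : ℕ}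
  {Θ : Set (EuclideanSpace ℝ (Fin q))} {a : ℝ → EuclideanSpace ℝ (Fin q) → ℝ}
  {θ : EuclideanSpace ℝ (Fin q)} {ε ξ : ℝ → Ω → ℝ} {ψ : ℝ → ℝ} {h : ℝ → ℂ} {f₀ : ℝ}
  {T₀ R₀ δ κ ρ : ℝ} {γ₁ γ₂ : Polynomial ℝ} {g : ℝ → ℝ → ℝ}

/-- On a nonempty shell the rate function is bounded by a multiple of the polynomial `γ₂`. -/
theorem rate_le_of_shell_nonempty (hf₀ : 0 < f₀) (hδ : 0 < δ)
    (hupper : DiscrepancyUpperBound Θ a θ T₀ R₀ κ ρ γ₁ γ₂)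
    (hlower : DiscrepancyLowerBound Θ a θ T₀ R₀ δ (2 * Real.pi * f₀) g) {T R : ℝ} (hT : T₀ < T)
    (hR : R₀ < R) (hne : (shell Θ a θ T R).Nonempty) :
    g T R ≤ δ ^ 2 / (2 * (2 * Real.pi * f₀)) * γ₂.eval R := by
  obtain ⟨u, hu⟩ := hne
  have h1 := (hlower T hT R hR u hu).trans (hupper.growth T hT R hR u hu)
  have e : 2 * (2 * Real.pi * f₀) * (δ ^ 2)⁻¹ * g T R =
      g T R / (δ ^ 2 / (2 * (2 * Real.pi * f₀))) := by
    field_simp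
  rw [e, div_le_iff₀ (by positivity)] at h1
  linarith

/-- The condition δ < 1/2 enters here, as δ⁻² ≥ 4. -/
theorem eight_mul_le {d x : ℝ} (hδ : 0 < δ) (hδ' : δ < 1 / 2) (hd : 0 ≤ d) (hx : 0 ≤ x) :
    8 * d * x ≤ 2 * d * (δ ^ 2)⁻¹ * x := by
  have h4 : 4 ≤ (δ ^ 2)⁻¹ := by
    rw [le_inv_comm₀ (by norm_num) (by positivity)]
    nlinarith
  nlinarith [mul_nonneg (mul_nonneg hd hx) (sub_nonneg.2 h4)]

set_option maxHeartbeats 1000000 in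
/-- The probability that `Φ(u, 0) ≤ 2 W(u)` at some point of one shell. -/
theorem exists_shell_bound [IsProbabilityMeasure P] (hΘ_bdd : Bornology.IsBounded Θ)
    (ha : IsRegressionFunction Θ a) (hθ : θ ∈ Θ) (hε : IsContinuousCenteredNoise P ε)
    (hfilter : IsFilteredNoise P ξ ψ ε) (hh : IsTransferFunction ψ h)
    (hb : ∀ x, ‖h x‖ ^ 2 ≤ f₀) (hf₀ : 0 < f₀) (hT₀ : 0 ≤ T₀)
    (hδ : 0 < δ) (hδ' : δ < 1 / 2) (hκ : 0 < κ) (hρ : 0 < ρ)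
    (hd : ∀ T > T₀, ∀ i, 0 < normEntry a θ T i)
    (hupper : DiscrepancyUpperBound Θ a θ T₀ R₀ κ ρ γ₁ γ₂)
    (hlower : DiscrepancyLowerBound Θ a θ T₀ R₀ δ (2 * Real.pi * f₀) g) :
    ∃ C₁ p G₀ : ℝ, 0 < C₁ ∧ 0 < p ∧ ∀ T > T₀, ∀ R > R₀, 1 ≤ R → G₀ ≤ g T R →
      P.real {ω | ∃ u ∈ shell Θ a θ T R,
        discrepancy a θ T u 0 ≤ 2 * noiseFunctional a θ T ε u ω} ≤
        C₁ * R ^ p * Real.exp (-(16 / 25 * g T R)) := by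
  obtain ⟨C, m, hC, hγ⟩ := exists_common_polynomial_bound γ₁ γ₂
  set d₀ : ℝ := 2 * Real.pi * f₀ with hd₀
  have hd₀pos : 0 < d₀ := by positivity
  -- The first summand makes y₀R^m dominate g on nonempty shells; the second is the lower bound on y
  -- that chaining requires.
  set y₀ : ℝ := δ ^ 2 / (2 * d₀) * C + (4 * q + 2) / ρ with hy₀
  have hy₀pos : 0 < y₀ := by positivity
  have hs1 : (2 : ℝ) ^ (-(ρ / 2)) < 1 :=
    Real.rpow_lt_one_of_one_lt_of_neg (by norm_num) (by linarith)
  obtain ⟨η₀, hη₀, hη₀κ, hη₀1, hη₀2⟩ := exists_small_scale C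
    (2 * d₀ * C * (2 : ℝ) ^ (2 * ρ) * y₀) hκ hρ
    (pow_pos (sub_pos.2 hs1) 2)
  set D : ℝ := 4 * (q + 1) / η₀ + 2 with hD
  have hD1 : 1 ≤ D := by
    have : 0 ≤ 4 * ((q : ℝ) + 1) / η₀ := by positivity
    linarith
  -- D·R^(1 + m/ρ) bounds the base of the net's cardinality estimate, and the final + 1 keeps p
  -- positive even for q = 0. The threshold 15/d₀ is 120/(8d₀), so that Φ_T ≥ 120 on the shell.
  refine ⟨(2 ^ (q + 1) + 1) * D ^ (2 * q), (1 + m / ρ) * (2 * q) + 1, 15 / d₀, by positivity,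
    by positivity, fun T hT R hR hR1 hg => ?_⟩
  have hT0 : 0 ≤ T := hT₀.trans hT.le
  have hdT := hd T hT
  have hR0 : 0 < R := by linarith
  rcases (shell Θ a θ T R).eq_empty_or_nonempty with hempty | hne
  · simp only [hempty, mem_empty_iff_false, false_and, exists_false]
    rw [show {ω : Ω | False} = ∅ from rfl, measureReal_empty]
    positivity
  have hgpos : 0 ≤ g T R := le_trans (by positivity) hg
  have hlowS : ∀ v ∈ shell Θ a θ T R, 8 * d₀ * g T R ≤ discrepancy a θ T v 0 := fun v hv =>
    (eight_mul_le hδ hδ' hd₀pos.le hgpos).trans (hlower T hT R hR v hv)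
  set L : ℝ := R ^ m with hL
  have hL1 : 1 ≤ L := one_le_pow₀ hR1
  set S := shell Θ a θ T R with hS
  have hSU : ∀ u ∈ S, u ∈ localDomain Θ a θ T := fun u hu => hu.1
  -- Then η^(2ρ) is of order R^(−2m): one factor R^(−m) offsets γ₁, the other offsets y = y₀R^m in
  -- the chaining condition.
  set η : ℝ := η₀ * R ^ (-(m / ρ)) with hη
  have hηpos : 0 < η := by positivity
  have hηη₀ : η ≤ η₀ := mul_le_of_le_one_right hη₀.le
    (Real.rpow_le_one_of_one_le_of_nonpos hR1 (by
      have : 0 ≤ m / ρ := by positivity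
      linarith))
  have hηpow : η ^ (2 * ρ) = η₀ ^ (2 * ρ) * (L ^ 2)⁻¹ := by
    rw [hη, Real.mul_rpow hη₀.le (by positivity), ← Real.rpow_mul hR0.le, hL, ← pow_mul,
      ← Real.rpow_natCast, ← Real.rpow_neg hR0.le]
    congr 2
    push_cast
    field_simp
  have hgy : g T R ≤ y₀ * L := by
    have h1 := rate_le_of_shell_nonempty hf₀ hδ hupper hlower hT hR hne
    have h2 : δ ^ 2 / (2 * d₀) * γ₂.eval R ≤ δ ^ 2 / (2 * d₀) * (C * L) :=
      mul_le_mul_of_nonneg_left (hγ R hR1).2 (by positivity)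
    have h3 : 0 ≤ (4 * (q : ℝ) + 2) / ρ * L := by positivity
    calc g T R ≤ δ ^ 2 / (2 * d₀) * (C * L) := h1.trans h2
      _ ≤ y₀ * L := by rw [hy₀, add_mul]; linarith
  have hincr : ∀ u ∈ S, ∀ v ∈ S, ∀ d, ‖u - v‖ ≤ d → d ≤ 2 * η →
      discrepancy a θ T u v ≤ C * L * d ^ (2 * ρ) := by
    intro u hu v hv d huv hdη
    refine (hupper.increment T hT R hR u hu v hv (by linarith)).trans ?_
    refine mul_le_mul (hγ R hR1).1 (Real.rpow_le_rpow (norm_nonneg _) huv (by positivity))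
      (by positivity) (by positivity)
  obtain ⟨N, hNS, hNc, hNP⟩ := exists_net_measure_le (P := P) (S := S) (r := R + 1) (η := η)
    (V := d₀ * C * L) (ρ := ρ) (y := y₀ * L) (W := noiseFunctional a θ T ε)
    (fun u hu => hu.2.2) hηpos (by positivity) hρ
    (fun u hu v hv d huv hdη => by
      refine hfilter.hasSubgaussianMGF_noiseFunctional_sub hε hh hb ha hθ hT0 hdT (hSU u hu)
        (hSU v hv) ?_
      calc d₀ * discrepancy a θ T u v ≤ d₀ * (C * L * d ^ (2 * ρ)) :=
            mul_le_mul_of_nonneg_left (hincr u hu v hv d huv hdη) hd₀pos.le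
        _ = d₀ * C * L * d ^ (2 * ρ) := by ring)
    (by
      filter_upwards [hε.continuousPaths] with ω hω
      exact (ha.continuousOn_noiseFunctional hΘ_bdd hθ hT0 hdT hω).mono hSU)
    (by
      rw [Real.mul_rpow (by norm_num) hηpos.le, hηpow]
      refine le_trans (le_of_eq ?_) hη₀2
      field_simp)
    (by
      have h1 : (4 * (q : ℝ) + 2) / ρ ≤ y₀ := by
        rw [hy₀]
        have : 0 ≤ δ ^ 2 / (2 * d₀) * C := by positivity
        linarith
      rw [div_le_iff₀ hρ] at h1
      have h5 := mul_le_mul_of_nonneg_left hL1 (mul_pos hy₀pos hρ).le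
      linarith)
  set M : ℝ := (2 * (q + 1) * |R + 1| / η + 2) ^ q with hM
  have hM1 : 1 ≤ M := by
    refine one_le_pow₀ ?_
    have : 0 ≤ 2 * ((q : ℝ) + 1) * |R + 1| / η := by positivity
    linarith
  have hMle : M ^ 2 ≤ D ^ (2 * q) * R ^ ((1 + m / ρ) * (2 * q) + 1) := by
    have h1 : 2 * (q + 1) * |R + 1| / η + 2 ≤ D * R ^ (1 + m / ρ) := by
      have hX : R * R ^ (m / ρ) = R ^ (1 + m / ρ) := by
        rw [Real.rpow_add hR0, Real.rpow_one]
      have hX1 : 1 ≤ R ^ (1 + m / ρ) := Real.one_le_rpow hR1 (by positivity)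
      have e : 2 * (q + 1) * |R + 1| / η = 2 * (q + 1) / η₀ * ((R + 1) * R ^ (m / ρ)) := by
        rw [abs_of_pos (by linarith), hη, Real.rpow_neg hR0.le]
        field_simp
      have h2 : (R + 1) * R ^ (m / ρ) ≤ 2 * R ^ (1 + m / ρ) := by
        rw [← hX]
        have h5 := mul_le_mul_of_nonneg_right hR1 (Real.rpow_pos_of_pos hR0 (m / ρ)).le
        linarith
      have h3 := mul_le_mul_of_nonneg_left h2 (by positivity : 0 ≤ 2 * ((q : ℝ) + 1) / η₀)
      rw [e, hD, add_mul]
      have h4 : 2 * ((q : ℝ) + 1) / η₀ * (2 * R ^ (1 + m / ρ)) =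
          4 * (q + 1) / η₀ * R ^ (1 + m / ρ) := by ring
      linarith
    have h2 : M ^ 2 ≤ (D * R ^ (1 + m / ρ)) ^ (2 * q) := by
      rw [hM, ← pow_mul, mul_comm q 2]
      exact pow_le_pow_left₀ (by positivity) h1 _
    refine h2.trans ?_
    rw [mul_pow, ← Real.rpow_natCast (R ^ (1 + m / ρ)), ← Real.rpow_mul hR0.le]
    push_cast
    gcongr
    linarith
  -- Chernoff's bound has exponent (2Φ/5)²/(2d₀Φ) = 2Φ/(25d₀), at least 16g/25 because Φ ≥ 8d₀g.
  have hsingle : ∀ v ∈ N, P.real {ω | 2 / 5 * discrepancy a θ T v 0 ≤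
      noiseFunctional a θ T ε v ω} ≤ Real.exp (-(16 / 25 * g T R)) := by
    intro v hv
    have hlow := hlowS v (hNS v hv)
    have hpos : 0 ≤ discrepancy a θ T v 0 := le_trans (by positivity) hlow
    refine ((hfilter.hasSubgaussianMGF_noiseFunctional hε hh hb ha hθ hT0 hdT
      (hSU v (hNS v hv))).measure_ge_le (by positivity)).trans ?_
    rw [Real.exp_le_exp, Real.coe_toNNReal _ (by positivity), neg_div, neg_le_neg_iff]
    rcases hpos.eq_or_lt with h0 | h0
    · have : g T R = 0 := by
        rw [← h0, mul_assoc] at hlow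
        have h8 : d₀ * g T R ≤ 0 := by linarith
        exact le_antisymm (nonpos_of_mul_nonpos_right h8 hd₀pos) hgpos
      simp [← h0, this]
    · rw [le_div_iff₀ (by positivity)]
      have := mul_le_mul_of_nonneg_right hlow hpos
      calc 16 / 25 * g T R * (2 * (d₀ * discrepancy a θ T v 0))
          = 4 / 25 * (8 * d₀ * g T R * discrepancy a θ T v 0) := by ring
        _ ≤ 4 / 25 * (discrepancy a θ T v 0 * discrepancy a θ T v 0) := by linarith
        _ = (2 / 5 * discrepancy a θ T v 0) ^ 2 := by ring
  -- With v the net point of u, 9Φ(v)/10 − 10 ≤ Φ(u) ≤ 2W(u) ≤ 2W(v) + 2, so W(v) ≥ 9Φ(v)/20 − 6,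
  -- which is at least 2Φ(v)/5 once Φ(v) ≥ 120.
  have hsub : {ω | ∃ u ∈ S, discrepancy a θ T u 0 ≤ 2 * noiseFunctional a θ T ε u ω} ⊆
      {ω | ¬ ∀ u ∈ S, ∃ v ∈ N, ‖u - v‖ ≤ η ∧
        noiseFunctional a θ T ε u ω ≤ noiseFunctional a θ T ε v ω + 1} ∪
      ⋃ v ∈ N, {ω | 2 / 5 * discrepancy a θ T v 0 ≤ noiseFunctional a θ T ε v ω} := by
    rintro ω ⟨u, hu, huω⟩
    by_contra hcon
    simp only [mem_union, mem_iUnion, mem_ofPred_eq, not_or, not_not, not_exists] at hcon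
    obtain ⟨v, hv, huv, hW⟩ := hcon.1 u hu
    refine hcon.2 v hv ?_
    have h1 := ha.discrepancy_triangle hθ hT0 hdT (hSU u hu) (hSU v (hNS v hv))
    have h2 : discrepancy a θ T u v ≤ 1 := by
      refine (hincr u hu v (hNS v hv) η huv (by linarith)).trans ?_
      rw [hηpow]
      calc C * L * (η₀ ^ (2 * ρ) * (L ^ 2)⁻¹) = C * η₀ ^ (2 * ρ) * L⁻¹ := by field_simp
        _ ≤ 1 * 1 := mul_le_mul hη₀1 (inv_le_one_of_one_le₀ hL1) (by positivity) (by norm_num)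
        _ = 1 := by norm_num
    have h3 : 120 ≤ discrepancy a θ T v 0 := by
      refine le_trans ?_ (hlowS v (hNS v hv))
      rw [div_le_iff₀ hd₀pos] at hg
      linarith
    linarith
  calc P.real {ω | ∃ u ∈ S, discrepancy a θ T u 0 ≤ 2 * noiseFunctional a θ T ε u ω}
      ≤ P.real {ω | ¬ ∀ u ∈ S, ∃ v ∈ N, ‖u - v‖ ≤ η ∧
          noiseFunctional a θ T ε u ω ≤ noiseFunctional a θ T ε v ω + 1} +
        P.real (⋃ v ∈ N, {ω | 2 / 5 * discrepancy a θ T v 0 ≤ noiseFunctional a θ T ε v ω}) :=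
        (measureReal_mono hsub).trans (measureReal_union_le _ _)
    _ ≤ 2 ^ (q + 1) * M ^ 2 * Real.exp (-(y₀ * L)) + M * Real.exp (-(16 / 25 * g T R)) := by
        refine add_le_add hNP ((measureReal_biUnion_finset_le _ _).trans
          ((Finset.sum_le_sum hsingle).trans ?_))
        rw [Finset.sum_const, nsmul_eq_mul]
        gcongr
    _ ≤ 2 ^ (q + 1) * M ^ 2 * Real.exp (-(16 / 25 * g T R)) +
        M ^ 2 * Real.exp (-(16 / 25 * g T R)) := by
        refine add_le_add (mul_le_mul_of_nonneg_left (Real.exp_le_exp.2 (by linarith))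
          (by positivity)) (mul_le_mul_of_nonneg_right (le_self_pow₀ hM1 two_ne_zero)
          (Real.exp_pos _).le)
    _ = (2 ^ (q + 1) + 1) * M ^ 2 * Real.exp (-(16 / 25 * g T R)) := by ring
    _ ≤ (2 ^ (q + 1) + 1) * (D ^ (2 * q) * R ^ ((1 + m / ρ) * (2 * q) + 1)) *
        Real.exp (-(16 / 25 * g T R)) := by gcongr
    _ = _ := by ring

end Deviation

/-! ### Summation over the shells. -/

section Deviation

variable {Ω : Type*} [MeasurableSpace Ω] {P : Measure Ω} {q : ℕ}
  {Θ : Set (EuclideanSpace ℝ (Fin q))} {a : ℝ → EuclideanSpace ℝ (Fin q) → ℝ}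
  {θ : EuclideanSpace ℝ (Fin q)} {ε : ℝ → Ω → ℝ} {T : ℝ}

/-- The deviation probability of a least squares estimator is bounded by the sum over shells. -/
theorem IsLeastSquaresEstimator.measure_le_tsum [IsProbabilityMeasure P]
    {est : Ω → EuclideanSpace ℝ (Fin q)}
    (hest : IsLeastSquaresEstimator P Θ a (observation a θ ε) T est)
    (ha : IsRegressionFunction Θ a) (hθ : θ ∈ Θ) (hε : IsContinuousCenteredNoise P ε)
    (hT : 0 ≤ T) (hd : ∀ i, 0 < normEntry a θ T i) {R : ℝ} {b : ℕ → ℝ} {s : ℝ}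
    (hb : ∀ j : ℕ, P.real {ω | ∃ u ∈ shell Θ a θ T (R + j),
      discrepancy a θ T u 0 ≤ 2 * noiseFunctional a θ T ε u ω} ≤ b j) (hs : HasSum b s) :
    P.real {ω | R ≤ ‖norming a θ T (est ω - θ)‖} ≤ s := by
  have hb0 : ∀ j, 0 ≤ b j := fun j => measureReal_nonneg.trans (hb j)
  have hle : P {ω | R ≤ ‖norming a θ T (est ω - θ)‖} ≤
      P (⋃ j : ℕ, {ω | ∃ u ∈ shell Θ a θ T (R + j),
        discrepancy a θ T u 0 ≤ 2 * noiseFunctional a θ T ε u ω}) := by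
    refine measure_mono_ae ?_
    filter_upwards [hest.mem, hest.isMinOn, hε.continuousPaths] with ω h1 h2 h3 hω
    replace hω : R ≤ ‖norming a θ T (est ω - θ)‖ := hω
    have hn := Nat.floor_le (sub_nonneg.2 hω)
    have hn' := Nat.lt_floor_add_one (‖norming a θ T (est ω - θ)‖ - R)
    refine mem_iUnion.2 ⟨⌊‖norming a θ T (est ω - θ)‖ - R⌋₊, norming a θ T (est ω - θ),
      ⟨⟨est ω, h1, rfl⟩, ?_, ?_⟩, ha.discrepancy_le_of_isMinOn hθ hT hd h3 h1 h2⟩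
    · linarith
    · linarith
  refine ENNReal.toReal_le_of_le_ofReal (hs.nonneg hb0) (hle.trans ?_)
  rw [← hs.tsum_eq, ENNReal.ofReal_tsum_of_nonneg hb0 hs.summable]
  refine (measure_iUnion_le _).trans (ENNReal.tsum_le_tsum fun j => ?_)
  rw [← ofReal_measureReal (measure_ne_top P _)]
  exact ENNReal.ofReal_le_ofReal (hb j)

/-- If a shell is empty then the estimator almost surely does not reach it. -/
theorem IsLeastSquaresEstimator.measure_eq_zero {X : ℝ → Ω → ℝ} {est : Ω → EuclideanSpace ℝ (Fin q)}
    (hest : IsLeastSquaresEstimator P Θ a X T est) (hconv : Convex ℝ Θ) (hθ : θ ∈ Θ)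
    {R : ℝ} (hR : 0 < R) (hempty : ¬ (shell Θ a θ T R).Nonempty) :
    P.real {ω | R ≤ ‖norming a θ T (est ω - θ)‖} = 0 := by
  rw [measureReal_def]
  have : P {ω | R ≤ ‖norming a θ T (est ω - θ)‖} = 0 := by
    refine measure_mono_null (t := {ω | ¬ est ω ∈ closure Θ}) (fun ω hω hmem => ?_)
      (ae_iff.1 hest.mem)
    exact hempty (shell_nonempty hconv hθ ⟨est ω, hmem, rfl⟩ hR hω)
  rw [this, ENNReal.toReal_zero]

end Deviation

/-- As 7/50 = 16/25 − 1/2, the hypothesis says R^(p + 2) ≤ exp(7x/50). This pays for R^p and leaves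
R^(−2), summable along R + j. -/
theorem exp_le_of_rpow_mul_exp_le {R p x : ℝ} (hR : 1 ≤ R)
    (h : R ^ ((p + 2) * (50 / 7)) * Real.exp (-x) ≤ 1) :
    R ^ p * Real.exp (-(16 / 25 * x)) ≤ (R ^ 2)⁻¹ * Real.exp (-(1 / 2 * x)) := by
  have hR0 : 0 < R := by linarith
  have e2 : (R ^ 2)⁻¹ = Real.exp (Real.log R * (-2)) := by
    rw [← Real.rpow_def_of_pos hR0, Real.rpow_neg hR0.le]
    norm_num
  rw [Real.rpow_def_of_pos hR0, ← Real.exp_add, Real.exp_le_one_iff] at h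
  rw [e2, Real.rpow_def_of_pos hR0, ← Real.exp_add, ← Real.exp_add, Real.exp_le_exp]
  nlinarith

end LSEDeviation

/-! ### The deviation bound: choice of constants and the separate ranges of T and R. -/

open LSEDeviation in
theorem corollary3
    -- the probability space and the parameter set
    {Ω : Type*} [MeasurableSpace Ω] (P : MeasureTheory.Measure Ω)
    [MeasureTheory.IsProbabilityMeasure P]
    {q : ℕ} (Θ : Set (EuclideanSpace ℝ (Fin q)))
    (hΘ_open : IsOpen Θ) (hΘ_bdd : Bornology.IsBounded Θ) (hΘ_convex : Convex ℝ Θ)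
    -- the regression function and the true parameter
    (a : ℝ → EuclideanSpace ℝ (Fin q) → ℝ) (ha : LSEDeviation.IsRegressionFunction Θ a)
    (θ : EuclideanSpace ℝ (Fin q)) (hθ : θ ∈ Θ)
    -- the noise: continuity and centering, filter representation, bounded transfer function
    (ε ξ : ℝ → Ω → ℝ) (ψ : ℝ → ℝ) (h : ℝ → ℂ) (f₀ : ℝ)
    (hε : LSEDeviation.IsContinuousCenteredNoise P ε)
    (hfilter : LSEDeviation.IsFilteredNoise P ξ ψ ε)
    (hh : LSEDeviation.IsTransferFunction ψ h)
    (hf₀ : IsLUB (Set.range fun x : ℝ => ‖h x‖ ^ 2) f₀) (hf₀_pos : 0 < f₀)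
    -- thresholds, constants, polynomials and rate function of the regression conditions
    (T₀ R₀ : ℝ) (hT₀ : 0 ≤ T₀) (hR₀ : 0 ≤ R₀)
    (δ κ ρ : ℝ) (hδ : 0 < δ) (hδ' : δ < 1 / 2) (hκ : 0 < κ) (hρ : 0 < ρ) (hρ' : ρ ≤ 1)
    (γ₁ γ₂ : Polynomial ℝ) (g : ℝ → ℝ → ℝ) (hg : LSEDeviation.IsRateFunction g)
    -- the norming matrix is well defined and invertible (a positive integral is a finite one)
    (hd : ∀ T > T₀, ∀ i, 0 < LSEDeviation.normEntry a θ T i)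
    (hupper : LSEDeviation.DiscrepancyUpperBound Θ a θ T₀ R₀ κ ρ γ₁ γ₂)
    (hlower : LSEDeviation.DiscrepancyLowerBound Θ a θ T₀ R₀ δ (2 * Real.pi * f₀) g) :
    ∀ β : ℝ, 0 < β → ∃ B₀ b₀ : ℝ, 0 < B₀ ∧ 0 < b₀ ∧ ρ / (ρ + (q : ℝ)) - β ≤ b₀ ∧
      ∀ T > T₀, ∀ est : Ω → EuclideanSpace ℝ (Fin q),
        LSEDeviation.IsLeastSquaresEstimator P Θ a (LSEDeviation.observation a θ ε) T est →
        ∀ R > R₀,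
          P.real {ω | R ≤ ‖LSEDeviation.norming a θ T (est ω - θ)‖} ≤
            B₀ * Real.exp (-(b₀ * g T R)) := by
  intro β hβ
  -- For q = 0 the ratio ρ/(ρ + q) is 1 and 1/2 may be too small, but the error vanishes identically
  -- and b₀ = 1 works.
  rcases Nat.eq_zero_or_pos q with rfl | hq
  · refine ⟨1, 1, one_pos, one_pos, ?_, fun T _ est _ R hR => ?_⟩
    · rw [Nat.cast_zero, add_zero, div_self hρ.ne']
      linarith
    · have hempty : {ω | R ≤ ‖norming a θ T (est ω - θ)‖} = ∅ := by
        refine eq_empty_of_forall_notMem fun ω hω => ?_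
        have hω' : R ≤ ‖norming a θ T (est ω - θ)‖ := hω
        rw [Subsingleton.elim (norming a θ T (est ω - θ)) 0, norm_zero] at hω'
        linarith
      rw [hempty, measureReal_empty]
      positivity
  have hb : ∀ x, ‖h x‖ ^ 2 ≤ f₀ := fun x => hf₀.1 ⟨x, rfl⟩
  obtain ⟨C₁, p, G₀, hC₁, hp, hshell⟩ := exists_shell_bound hΘ_bdd ha hθ hε hfilter hh hb hf₀_pos
    hT₀ hδ hδ' hκ hρ hd hupper hlower
  obtain ⟨pa, hpa, pb, hpb, hdecay⟩ := eventually_prod_iff.1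
    ((hg.decay ((p + 2) * (50 / 7)) (by positivity)).eventually_le_const one_pos)
  obtain ⟨T₁, hT₁⟩ := eventually_atTop.1 hpa
  obtain ⟨R₁, hR₁⟩ := eventually_atTop.1 hpb
  obtain ⟨CU, hCU⟩ := exists_localDomain_bound (a := a) (θ := θ) hΘ_bdd hT₀
    (T₁ := max T₁ (T₀ + 1)) (by linarith [le_max_right T₁ (T₀ + 1)]) hd
  set X : ℝ := max (max R₁ CU) 1 with hX
  obtain ⟨G₂, hG₂⟩ := (isCompact_Icc (a := (0 : ℝ)) (b := X)).exists_bound_of_continuousOn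
    (f := fun R => δ ^ 2 / (2 * (2 * Real.pi * f₀)) * γ₂.eval R)
    (γ₂.continuous.const_mul _).continuousOn
  have hZ : Summable fun j : ℕ => (((j : ℝ) + 1) ^ 2)⁻¹ := by
    have := (summable_nat_add_iff 1).2 (Real.summable_nat_pow_inv.2 one_lt_two)
    simpa using this
  set Z : ℝ := ∑' j : ℕ, (((j : ℝ) + 1) ^ 2)⁻¹ with hZd
  have hZ0 : 0 ≤ Z := tsum_nonneg fun j => by positivity
  -- The summands of B₀ serve, in order, the series over shells, the case g ≤ G₀, and the case R ≤
  -- X.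
  refine ⟨C₁ * Z + Real.exp (1 / 2 * |G₀|) + Real.exp (1 / 2 * |G₂|), 1 / 2, by positivity,
    by norm_num, ?_, fun T hT est hest R hR => ?_⟩
  · have hq1 : (1 : ℝ) ≤ q := by exact_mod_cast hq
    have : ρ / (ρ + q) ≤ 1 / 2 := by
      rw [div_le_iff₀ (by positivity)]
      linarith
    linarith
  have hT0 : 0 < T := hT₀.trans_lt hT
  have hR0 : 0 < R := hR₀.trans_lt hR
  have htriv : ∀ K, g T R ≤ K → P.real {ω | R ≤ ‖norming a θ T (est ω - θ)‖} ≤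
      Real.exp (1 / 2 * |K|) * Real.exp (-(1 / 2 * g T R)) := by
    intro K hK
    refine measureReal_le_one.trans ?_
    rw [← Real.exp_add]
    exact Real.one_le_exp (by linarith [le_abs_self K])
  have hexp := Real.exp_pos (-(1 / 2 * g T R))
  have hCZ : 0 ≤ C₁ * Z := by positivity
  have hE₀ := Real.exp_pos (1 / 2 * |G₀|)
  have hE₂ := Real.exp_pos (1 / 2 * |G₂|)
  by_cases hne : (shell Θ a θ T R).Nonempty
  swap
  · rw [hest.measure_eq_zero hΘ_convex hθ hR0 hne]
    positivity
  rcases le_or_gt R X with hRX | hRX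
  · have h1 := (rate_le_of_shell_nonempty hf₀_pos hδ hupper hlower hT hR hne).trans
      ((le_abs_self _).trans (hG₂ R ⟨hR0.le, hRX⟩))
    exact (htriv _ h1).trans (mul_le_mul_of_nonneg_right (by linarith) hexp.le)
  have hR1 : 1 ≤ R := (le_max_right _ _).trans hRX.le
  have hRR₁ : R₁ ≤ R := ((le_max_left _ _).trans (le_max_left _ _)).trans hRX.le
  -- For T < T₁ every point of the local domain has norm at most `CU` ≤ X < R, so the shell would be
  -- empty.
  have hTT₁ : T₁ ≤ T := by
    by_contra hlt
    obtain ⟨u, hu⟩ := hne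
    have h1 := hCU T hT ((not_le.1 hlt).le.trans (le_max_left _ _)) u hu.1
    have h2 : CU ≤ X := (le_max_right _ _).trans (le_max_left _ _)
    have h3 : R ≤ ‖u‖ := hu.2.1
    linarith
  rcases le_or_gt (g T R) G₀ with hG | hG
  · exact (htriv _ hG).trans (mul_le_mul_of_nonneg_right (by linarith) hexp.le)
  -- Majorant for shell j: its polynomial factor becomes (R + j)^(−2) ≤ (j + 1)^(−2), and
  -- monotonicity replaces `g T (R + j)` by `g T R`.
  have hsum := (hZ.hasSum.mul_left C₁).mul_right (Real.exp (-(1 / 2 * g T R)))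
  refine (hest.measure_le_tsum ha hθ hε hT0.le (hd T hT) (fun j => ?_) hsum).trans
    (mul_le_mul_of_nonneg_right (by linarith) hexp.le)
  have hj0 : (0 : ℝ) ≤ j := j.cast_nonneg
  have hRj : 1 ≤ R + j := by linarith
  have hmono : g T R ≤ g T (R + j) :=
    hg.mono T hT0 hR0 (show (0 : ℝ) < R + j by linarith) (by linarith)
  refine (hshell T hT (R + j) (by linarith) hRj (hG.le.trans hmono)).trans ?_
  have hdec := exp_le_of_rpow_mul_exp_le hRj
    (hdecay (hT₁ T hTT₁) (hR₁ (R + j) (by linarith)))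
  rw [mul_assoc, mul_assoc]
  refine mul_le_mul_of_nonneg_left (hdec.trans (mul_le_mul ?_ ?_ (Real.exp_pos _).le
    (by positivity))) hC₁.le
  · exact inv_anti₀ (by positivity) (pow_le_pow_left₀ (by positivity) (by linarith) 2)
  · exact Real.exp_le_exp.2 (by linarith)
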